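/- **Proposition (bound on the constraint-set error term).** Let $\Omega\subset\mathbb{R}^n$ ($n\ge 1$) be a bounded Lipschitz domain, $f\in L^2(\Omega)$, $h\in H^{1/2}(\partial\Omega)$, and let $\psi\in H^1(\Omega)$ satisfy $\psi\le h$ a.e. on $\partial\Omega$ in the sense of traces. Let $b_1,\dots,b_n,k$ be real constants and let $A=-\Delta+\sum_{i=1}^n b_i\partial_{x_i}+k\,\mathrm{Id}\colon H^1(\Omega)\to H^1(\Omega)^*$, that is, $$\langle Au,v\rangle=\int_\Omega \nabla u\cdot\nabla v+\sum_{i=1}^n b_i\,\partial_{x_i}u\,v+k\,u\,v .$$ Put $K=\{u\in H^1(\Omega): u\ge\psi \text{ a.e. in }\Omega,\ u|_{\partial\Omega}=h\}$, and let $u^*\in K$ be a solution of the variational inequality $$\langle Au^*-f,\,u^*-v\rangle\le 0\qquad\text{for all } v\in K .$$ For penalty weights $w_{b_1},w_{o_1}\in\mathbb{R}$ and $u\in H^1(\Omega)$ let $$R_1(u)=w_{b_1}\int_{\partial\Omega}|u-h|^2+w_{o_1}\int_\Omega|(\psi-u)^+|^2 .$$ Assume that $u^*\in H^2(\Omega)$,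 and let $\hat u_{\mathcal A}\in H^1(\Omega)$ (the computed solution) be any function with $\hat u_{\mathcal A}|_{\partial\Omega}=h$. Then for every $\varepsilon>0$: if $$w_{o_1}\ \ge\ \frac{1}{4\varepsilon}\,\|Au^*-f\|_{L^2(\Omega)}^2 ,$$ then $$\langle Au^*-f,\ u^*-\hat u_{\mathcal A}\rangle-R_1(\hat u_{\mathcal A})\ \le\ \varepsilon .$$ -/

import Mathlib

open MeasureTheory Set Filter Topology
open scoped ENNReal NNReal ContDiff

namespace ObstacleProblem

noncomputable section

/-- `ℝⁿ` with its Euclidean norm. -/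
abbrev Rn (n : ℕ) : Type := EuclideanSpace ℝ (Fin n)

/-- Lebesgue measure on `Ω`. -/
def volOn {n : ℕ} (Ω : Set (Rn n)) : Measure (Rn n) := volume.restrict Ω

/-- Surface measure on `∂Ω`: the `(n-1)`-dimensional Hausdorff measure, normalised so that it is
Lebesgue measure on Euclidean `(n-1)`-space, restricted to `∂Ω`. -/
def surfaceMeasure {n : ℕ} (Ω : Set (Rn n)) : Measure (Rn n) :=
  (μHE[n - 1] : Measure (Rn n)).restrict (frontier Ω)

/-- Classical partial derivative `∂φ/∂xᵢ`. -/
def partialDeriv {n : ℕ} (i : Fin n) (φ : Rn n → ℝ) (x : Rn n) : ℝ :=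
  fderiv ℝ φ x (EuclideanSpace.single i 1)

/-- `Ω` is a bounded Lipschitz domain: nonempty, open, connected, bounded, and near each boundary
point `x`, for a suitable unit vector `e`, it is the set of points lying strictly above the graph of
a Lipschitz function `γ` defined on the hyperplane orthogonal to `e` (the height being measured in
direction `e`). -/
structure IsBoundedLipschitzDomain {n : ℕ} (Ω : Set (Rn n)) : Prop where
  isOpen : IsOpen Ω
  isConnected : IsConnected Ω
  isBounded : Bornology.IsBounded Ω
  locally_epigraph : ∀ x ∈ frontier Ω, ∃ U : Set (Rn n), IsOpen U ∧ x ∈ U ∧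
    ∃ e : Rn n, ‖e‖ = 1 ∧ ∃ γ : (Submodule.span ℝ {e})ᗮ → ℝ, (∃ L : ℝ≥0, LipschitzWith L γ) ∧
      ∀ y ∈ U, (y ∈ Ω ↔ γ ((Submodule.span ℝ {e})ᗮ.orthogonalProjectionOnto y) < inner ℝ e y)

/-- `g` is the weak partial derivative `∂u/∂xᵢ` on `Ω`, tested against `C_c^∞(Ω)`. -/
def HasWeakPartial {n : ℕ} (Ω : Set (Rn n)) (i : Fin n) (u g : Rn n → ℝ) : Prop :=
  ∀ φ : Rn n → ℝ, ContDiff ℝ ∞ φ → HasCompactSupport φ → tsupport φ ⊆ Ω →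
    ∫ x in Ω, u x * partialDeriv i φ x = -∫ x in Ω, g x * φ x

/-- `u ∈ L²(Ω)`. -/
def MemL2 {n : ℕ} (Ω : Set (Rn n)) (u : Rn n → ℝ) : Prop := MemLp u 2 (volOn Ω)

/-- The norm of `L²(Ω)`. -/
def normL2 {n : ℕ} (Ω : Set (Rn n)) (u : Rn n → ℝ) : ℝ := (eLpNorm u 2 (volOn Ω)).toReal

/-- `u ∈ H¹(Ω)`. -/
def MemH1 {n : ℕ} (Ω : Set (Rn n)) (u : Rn n → ℝ) : Prop :=
  MemL2 Ω u ∧ ∀ i : Fin n, ∃ g : Rn n → ℝ, MemL2 Ω g ∧ HasWeakPartial Ω i u g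

open Classical in
/-- The weak partial derivative `∂u/∂xᵢ ∈ L²(Ω)` (unique a.e. in `Ω`); the value is only meaningful
when this derivative exists. -/
def weakPartial {n : ℕ} (Ω : Set (Rn n)) (i : Fin n) (u : Rn n → ℝ) : Rn n → ℝ :=
  if hu : ∃ g : Rn n → ℝ, MemL2 Ω g ∧ HasWeakPartial Ω i u g then hu.choose else 0

/-- `u ∈ H²(Ω)`. -/
def MemH2 {n : ℕ} (Ω : Set (Rn n)) (u : Rn n → ℝ) : Prop :=
  MemH1 Ω u ∧ ∀ i : Fin n, MemH1 Ω (weakPartial Ω i u)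

/-- `g` is the trace `u|_∂Ω ∈ L²(∂Ω)` of `u ∈ H¹(Ω)`. The trace operator is the continuous
extension to `H¹(Ω)` of the restriction map `φ ↦ φ|_∂Ω` on functions smooth up to the boundary, and
this is its graph: there are smooth `φₖ → u` in `H¹(Ω)` with `φₖ|_∂Ω → g` in `L²(∂Ω)`. -/
def HasTrace {n : ℕ} (Ω : Set (Rn n)) (u g : Rn n → ℝ) : Prop :=
  MemLp g 2 (surfaceMeasure Ω) ∧
  ∃ φ : ℕ → Rn n → ℝ, (∀ m, ContDiff ℝ ∞ (φ m)) ∧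
    Tendsto (fun m => eLpNorm (fun x => φ m x - u x) 2 (volOn Ω)) atTop (𝓝 0) ∧
    (∀ i : Fin n, Tendsto
      (fun m => eLpNorm (fun x => partialDeriv i (φ m) x - weakPartial Ω i u x) 2 (volOn Ω))
      atTop (𝓝 0)) ∧
    Tendsto (fun m => eLpNorm (fun x => φ m x - g x) 2 (surfaceMeasure Ω)) atTop (𝓝 0)

/-- `h ∈ H^{1/2}(∂Ω)`, the space of traces of `H¹(Ω)` functions. -/
def MemHHalf {n : ℕ} (Ω : Set (Rn n)) (h : Rn n → ℝ) : Prop :=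
  ∃ w : Rn n → ℝ, MemH1 Ω w ∧ HasTrace Ω w h

/-- The constraint set `K`: functions in `H¹(Ω)` with `u ≥ ψ` a.e. in `Ω` and `u = h` on `∂Ω`. -/
def constraintSet {n : ℕ} (Ω : Set (Rn n)) (ψ h : Rn n → ℝ) : Set (Rn n → ℝ) :=
  {u | MemH1 Ω u ∧ (∀ᵐ x ∂(volOn Ω), ψ x ≤ u x) ∧ HasTrace Ω u h}

/-- The duality pairing `⟨A u, v⟩ = ∫_Ω ∇u · ∇v + ∑ᵢ bᵢ ∂ᵢu v + k u v`, for
`A = -Δ + ∑ᵢ bᵢ ∂ᵢ + k Id : H¹(Ω) → H¹(Ω)*`. -/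
def pairingA {n : ℕ} (Ω : Set (Rn n)) (b : Fin n → ℝ) (k : ℝ) (u v : Rn n → ℝ) : ℝ :=
  ∫ x in Ω, ((∑ i, weakPartial Ω i u x * weakPartial Ω i v x)
    + (∑ i, b i * weakPartial Ω i u x * v x) + k * u x * v x)

/-- The duality pairing `⟨A u - f, v⟩`. -/
def pairingRes {n : ℕ} (Ω : Set (Rn n)) (b : Fin n → ℝ) (k : ℝ) (f u v : Rn n → ℝ) : ℝ :=
  pairingA Ω b k u v - ∫ x in Ω, f x * v x

/-- For `u ∈ H²(Ω)`, the function `A u = -Δu + ∑ᵢ bᵢ ∂ᵢu + k u ∈ L²(Ω)`. -/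
def strongA {n : ℕ} (Ω : Set (Rn n)) (b : Fin n → ℝ) (k : ℝ) (u : Rn n → ℝ) (x : Rn n) : ℝ :=
  -(∑ i, weakPartial Ω i (weakPartial Ω i u) x) + (∑ i, b i * weakPartial Ω i u x) + k * u x

/-- `u` solves the variational inequality: `u ∈ K` and `⟨A u - f, u - v⟩ ≤ 0` for all `v ∈ K`. -/
def IsVISolution {n : ℕ} (Ω : Set (Rn n)) (b : Fin n → ℝ) (k : ℝ) (f ψ h u : Rn n → ℝ) : Prop :=
  u ∈ constraintSet Ω ψ h ∧
    ∀ v ∈ constraintSet Ω ψ h, pairingRes Ω b k f u (fun x => u x - v x) ≤ 0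

/-- The obstacle loss `L_o(u) = ∫_Ω |(ψ - u)⁺|²`. -/
def lossObstacle {n : ℕ} (Ω : Set (Rn n)) (ψ u : Rn n → ℝ) : ℝ :=
  ∫ x in Ω, |max (ψ x - u x) 0| ^ 2

/-- The boundary loss `L_b(g) = ∫_∂Ω |g - h|²` on `L²(∂Ω)`. -/
def lossBoundary {n : ℕ} (Ω : Set (Rn n)) (h g : Rn n → ℝ) : ℝ :=
  ∫ x, |g x - h x| ^ 2 ∂(surfaceMeasure Ω)

/-- The penalty `R₁(u) = w_b L_b(u|_∂Ω) + w_o L_o(u)`, where `g` stands for the trace `u|_∂Ω`. -/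
def penaltyR {n : ℕ} (Ω : Set (Rn n)) (ψ h : Rn n → ℝ) (wb wo : ℝ) (u g : Rn n → ℝ) : ℝ :=
  wb * lossBoundary Ω h g + wo * lossObstacle Ω ψ u

end

end ObstacleProblem

namespace ObstacleProblem

/-! Let `p = (ψ - û)⁺`. Then `û + p = max(û, ψ)` lies above `ψ`. The trace of `ψ - û` is
nonpositive, so `p` has zero trace and `û + p` still has trace `h`; hence `û + p ∈ K`. The
variational inequality tested with it gives `⟨Au* - f, u* - û⟩ ≤ ⟨Au* - f, p⟩`. As `u* ∈ H²` and `p`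
has zero trace, the right side is the `L²` product of `Au* - f` and `p`, at most `XY` with `X = ‖Au*
- f‖` and `Y = ‖p‖`. The boundary loss vanishes and the obstacle loss is `Y²`, so Young's inequality
`XY ≤ ε + X²Y²/(4ε)` and the bound on the weight finish the proof.

Two facts about traces carry this argument, both proved from the definition of the trace by smooth
approximation. They are phrased with `SmoothApprox`, where the gradient `G` is explicit data, so
that it can be computed for sums and positive parts; `weakPartial` is a choice and is matched to `G`
only almost everywhere.

The first is `SmoothApprox.posPart`: smooth functions `F` vanishing on `(-∞, 0]` are applied to the
approximants, and then `F` tends to the positive part.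

The second is Green's formula, `SmoothApprox.integral_mul_grad`. Weak derivatives are tested only
against `C_c^∞(Ω)`, so `p` is multiplied by a cutoff `η` equal to `1` off a boundary strip of width
`t`, with `|∇η| ≤ 4/t`. The factor `1/t` is absorbed because a function of zero trace is `O(t)` in
`L²` of the strip (`SmoothApprox.exists_eLpNorm_strip_le`); the remaining factors are norms of fixed
`L²` functions over the strip and tend to `0`. The strip bound comes from a one-dimensional estimate
along lines transversal to the boundary, integrated in Lipschitz charts
(`exists_lintegral_strip_le`). -/

/-! ### Estimates on an interval. -/

lemma ennreal_add_sq_le (a b : ℝ≥0∞) : (a + b) ^ 2 ≤ 2 * a ^ 2 + 2 * b ^ 2 := by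
  have h := ENNReal.rpow_add_le_mul_rpow_add_rpow a b (p := 2) (by norm_num)
  norm_num at h
  rw [← mul_add]
  exact h

/-- The square of an integral is at most the measure times the integral of the square. -/
lemma sq_lintegral_le {α : Type*} [MeasurableSpace α] (μ : Measure α) {g : α → ℝ≥0∞}
    (hg : AEMeasurable g μ) : (∫⁻ x, g x ∂μ) ^ 2 ≤ μ univ * ∫⁻ x, g x ^ 2 ∂μ := by
  have h := ENNReal.lintegral_mul_le_Lp_mul_Lq μ Real.HolderConjugate.two_two
    (f := fun _ => 1) (g := g) aemeasurable_const hg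
  simp only [Pi.mul_apply, one_mul, ENNReal.one_rpow, lintegral_one] at h
  calc (∫⁻ x, g x ∂μ) ^ 2 ≤ (μ univ ^ (1 / 2 : ℝ) * (∫⁻ x, g x ^ (2 : ℝ) ∂μ) ^ (1 / 2 : ℝ)) ^ 2 := by
        gcongr
    _ = _ := by
      rw [mul_pow, ← ENNReal.rpow_natCast, ← ENNReal.rpow_mul, ← ENNReal.rpow_natCast,
        ← ENNReal.rpow_mul]
      norm_num

/-- A one-dimensional Poincaré inequality with boundary term. -/
lemma lintegral_Ioo_sq_le {f : ℝ → ℝ} (hf : ContDiff ℝ 1 f) (a : ℝ) (T : ℝ) :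
    ∫⁻ s in Ioo a (a + T), ‖f s‖ₑ ^ 2 ≤ 2 * ENNReal.ofReal T * ‖f a‖ₑ ^ 2
      + 2 * ENNReal.ofReal T ^ 2 * ∫⁻ s in Ioo a (a + T), ‖deriv f s‖ₑ ^ 2 := by
  have hd : Continuous (deriv f) := hf.continuous_deriv le_rfl
  set I := ∫⁻ s in Ioo a (a + T), ‖deriv f s‖ₑ ^ 2
  have hvol : (volume.restrict (Ioo a (a + T))) univ = ENNReal.ofReal T := by simp
  have key : ∀ s ∈ Ioo a (a + T), ‖f s‖ₑ ^ 2 ≤ 2 * ‖f a‖ₑ ^ 2 + 2 * (ENNReal.ofReal T * I) := by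
    intro s hs
    have h1 : f s = f a + ∫ r in a..s, deriv f r := by
      rw [intervalIntegral.integral_deriv_eq_sub
        (fun x _ => (hf.differentiable one_ne_zero).differentiableAt)
        (hd.intervalIntegrable _ _)]
      ring
    have h2 : ‖∫ r in a..s, deriv f r‖ₑ ≤ ∫⁻ r in Ioo a (a + T), ‖deriv f r‖ₑ := by
      rw [intervalIntegral.integral_of_le hs.1.le]
      exact (enorm_integral_le_lintegral_enorm _).trans
        (lintegral_mono_set fun r hr => ⟨hr.1, hr.2.trans_lt hs.2⟩)
    have h3 := sq_lintegral_le (volume.restrict (Ioo a (a + T))) (g := fun r => ‖deriv f r‖ₑ)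
      hd.enorm.measurable.aemeasurable
    rw [hvol] at h3
    calc ‖f s‖ₑ ^ 2 ≤ (‖f a‖ₑ + ∫⁻ r in Ioo a (a + T), ‖deriv f r‖ₑ) ^ 2 := by
          rw [h1]; gcongr; exact (enorm_add_le _ _).trans (by gcongr)
      _ ≤ _ := ennreal_add_sq_le _ _
      _ ≤ _ := by gcongr
  calc ∫⁻ s in Ioo a (a + T), ‖f s‖ₑ ^ 2
      ≤ ∫⁻ _ in Ioo a (a + T), (2 * ‖f a‖ₑ ^ 2 + 2 * (ENNReal.ofReal T * I)) :=
        setLIntegral_mono measurable_const key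
    _ = _ := by
      rw [lintegral_const, hvol]; ring

/-! ### Fubini along a direction, and graphs over a hyperplane. -/

variable {n : ℕ}

/-- Fubini along the direction of a unit vector. -/
lemma lintegral_eq_lintegral_orthogonal {e : Rn n} (he : ‖e‖ = 1) {F : Rn n → ℝ≥0∞}
    (hF : Measurable F) :
    ∫⁻ x, F x = ∫⁻ y : (Submodule.span ℝ {e})ᗮ, ∫⁻ s : ℝ, F (y + s • e) := by
  have h1 := (Submodule.span ℝ {e}).measurePreserving_measurableEquivProd (0 : Rn n)
  rw [InnerProductSpace.euclideanHausdorffMeasure_eq_volume] at h1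
  have h2 := h1.symm
  rw [← h2.lintegral_comp hF, Measure.volume_eq_prod, lintegral_prod_symm'
    (fun z => F (((Submodule.span ℝ {e}).measurableEquivProd (0 : Rn n)).symm z))
    (hF.comp (MeasurableEquiv.measurable _))]
  refine lintegral_congr fun y => ?_
  -- Since `e` is a unit vector, `s ↦ s • e` is an isometry onto its span and no Jacobian appears.
  have h3 := (LinearIsometryEquiv.toSpanUnitSingleton (𝕜 := ℝ) e he).measurePreserving
  rw [← h3.lintegral_comp_emb
    (LinearIsometryEquiv.toSpanUnitSingleton e he).toHomeomorph.measurableEmbedding]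
  refine lintegral_congr fun s => ?_
  simp [add_comm]

/-- The point of the graph of `γ` over `y`, the height being measured in direction `e`. -/
noncomputable def graphPoint (e : Rn n) (γ : (Submodule.span ℝ {e})ᗮ → ℝ)
    (y : (Submodule.span ℝ {e})ᗮ) : Rn n := y + γ y • e

lemma orthogonalProjectionOnto_add_smul (e : Rn n) (y : (Submodule.span ℝ {e})ᗮ) (s : ℝ) :
    (Submodule.span ℝ {e})ᗮ.orthogonalProjectionOnto (y + s • e) = y := by
  rw [map_add, Submodule.orthogonalProjectionOnto_mem_subspace_eq_self,
    Submodule.orthogonalProjectionOnto_apply_of_mem_orthogonal, add_zero]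
  rw [Submodule.orthogonal_orthogonal]
  exact Submodule.smul_mem _ _ (Submodule.mem_span_singleton_self e)

lemma inner_add_smul_self {e : Rn n} (he : ‖e‖ = 1) (y : (Submodule.span ℝ {e})ᗮ) (s : ℝ) :
    inner ℝ e ((y : Rn n) + s • e) = s := by
  rw [inner_add_right, inner_smul_right, real_inner_self_eq_norm_sq, he,
    Submodule.mem_orthogonal _ _ |>.1 y.2 e (Submodule.mem_span_singleton_self e)]
  simp

lemma orthogonalProjectionOnto_add_inner_smul {e : Rn n} (he : ‖e‖ = 1) (x : Rn n) :
    (((Submodule.span ℝ {e})ᗮ.orthogonalProjectionOnto x : (Submodule.span ℝ {e})ᗮ) : Rn n)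
      + (inner ℝ e x : ℝ) • e = x := by
  have h := Submodule.starProjection_unit_singleton ℝ he x
  have h2 := (Submodule.span ℝ {e}).starProjection_add_starProjection_orthogonal x
  rw [h] at h2
  rw [add_comm]; exact h2

/-- The projection of a graph does not increase Hausdorff measure. -/
lemma setLIntegral_graphPoint_le (hn : 1 ≤ n) {Ω : Set (Rn n)} {e : Rn n} (he : ‖e‖ = 1)
    {γ : (Submodule.span ℝ {e})ᗮ → ℝ} (hγ : Continuous γ) {D : Set (Submodule.span ℝ {e})ᗮ}
    (hD : ∀ y ∈ D, graphPoint e γ y ∈ frontier Ω) {F : Rn n → ℝ≥0∞}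
    (hF : Measurable F) :
    ∫⁻ y in D, F (graphPoint e γ y) ≤ ∫⁻ x, F x ∂(surfaceMeasure Ω) := by
  have hΓ : Measurable (graphPoint e γ) := by
    unfold graphPoint
    exact (continuous_subtype_val.add (hγ.smul continuous_const)).measurable
  rw [← lintegral_map hF hΓ]
  refine lintegral_mono' ?_ le_rfl
  refine Measure.le_iff.2 fun B hB => ?_
  rw [Measure.map_apply hΓ hB, Measure.restrict_apply (hΓ hB), surfaceMeasure,
    Measure.restrict_apply hB]
  have hrank : Module.finrank ℝ (Submodule.span ℝ {e})ᗮ = n - 1 := by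
    have h1 := (Submodule.span ℝ {e}).finrank_add_finrank_orthogonal
    rw [finrank_span_singleton (by rintro rfl; simp at he), finrank_euclideanSpace_fin] at h1
    omega
  -- The orthogonal projection is a 1-Lipschitz left inverse of `graphPoint`, so only the Lipschitz
  -- image bound for Hausdorff measure is needed, and no area formula.
  have hsub : graphPoint e γ ⁻¹' B ∩ D ⊆
      (Submodule.span ℝ {e})ᗮ.orthogonalProjectionOnto '' (B ∩ frontier Ω) := fun y hy =>
    ⟨graphPoint e γ y, ⟨hy.1, hD y hy.2⟩, orthogonalProjectionOnto_add_smul e y _⟩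
  rw [← InnerProductSpace.euclideanHausdorffMeasure_eq_volume, hrank]
  refine (measure_mono hsub).trans ?_
  have hlip : LipschitzWith 1 (Submodule.span ℝ {e})ᗮ.orthogonalProjectionOnto :=
    Submodule.lipschitzWith_orthogonalProjectionOnto _
  have h := hlip.hausdorffMeasure_image_le (d := ((n - 1 : ℕ) : ℝ)) (by positivity)
    (B ∩ frontier Ω)
  simp only [ENNReal.coe_one, ENNReal.one_rpow, one_mul] at h
  simp only [Measure.euclideanHausdorffMeasure_def, Measure.smul_apply]
  exact smul_le_smul_of_nonneg_left h zero_le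

/-! ### The boundary strip and its `L²` estimate. -/

/-- The points of `Ω` at distance less than `t` from the complement of `Ω`. -/
def strip (Ω : Set (Rn n)) (t : ℝ) : Set (Rn n) := {x | x ∈ Ω ∧ Metric.infDist x Ωᶜ < t}

lemma isOpen_strip {Ω : Set (Rn n)} (hΩ : IsOpen Ω) (t : ℝ) : IsOpen (strip Ω t) :=
  hΩ.inter (isOpen_lt (Metric.continuous_infDist_pt _) continuous_const)

lemma strip_subset (Ω : Set (Rn n)) (t : ℝ) : strip Ω t ⊆ Ω := fun _ hx => hx.1

/-- A nearest point of the complement serves: the ball around `x` reaching up to it lies in the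
closure of `Ω`. -/
lemma exists_frontier_dist_lt {Ω : Set (Rn n)} (hΩ : IsOpen Ω) (hne : Ωᶜ.Nonempty) {t : ℝ}
    {x : Rn n} (hx : x ∈ strip Ω t) : ∃ z ∈ frontier Ω, dist x z < t := by
  obtain ⟨z, hz, hd⟩ := hΩ.isClosed_compl.exists_infDist_eq_dist hne x
  refine ⟨z, ?_, hd ▸ hx.2⟩
  rw [hΩ.frontier_eq]
  refine ⟨Metric.closedBall_infDist_compl_subset_closure hx.1 ?_, hz⟩
  rw [Metric.mem_closedBall, dist_comm, hd]

/-- Near a boundary point, a bounded Lipschitz domain is described by a Lipschitz graph, with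
uniform control of the thin strip above the graph. -/
lemma exists_graph_near {Ω : Set (Rn n)} (hΩ : IsBoundedLipschitzDomain Ω)
    (hne : Ωᶜ.Nonempty) {x₀ : Rn n} (hx₀ : x₀ ∈ frontier Ω) :
    ∃ e : Rn n, ‖e‖ = 1 ∧ ∃ γ : (Submodule.span ℝ {e})ᗮ → ℝ, Continuous γ ∧
      ∃ (L : ℝ≥0) (ρ : ℝ) (D : Set (Submodule.span ℝ {e})ᗮ), 0 < ρ ∧ MeasurableSet D ∧
      (∀ y ∈ D, graphPoint e γ y ∈ frontier Ω) ∧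
      ∀ t, 0 < t → t < ρ →
        (∀ y ∈ D, ∀ s ∈ Ioo (γ y) (γ y + (L + 1) * t), (y : Rn n) + s • e ∈ Ω) ∧
        (∀ (y : (Submodule.span ℝ {e})ᗮ) (s : ℝ),
          (y : Rn n) + s • e ∈ strip Ω t ∩ Metric.ball x₀ ρ →
            y ∈ D ∧ s ∈ Ioo (γ y) (γ y + (L + 1) * t)) := by
  obtain ⟨U, hU, hxU, e, he, γ, ⟨L, hL⟩, hUγ⟩ := hΩ.locally_epigraph x₀ hx₀
  obtain ⟨R, hR, hRU⟩ := Metric.isOpen_iff.1 hU x₀ hxU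
  have hopen := hΩ.isOpen
  have hfront : frontier Ω = closure Ω \ Ω := hopen.frontier_eq
  rw [hfront] at hx₀ ⊢
  set π := (Submodule.span ℝ {e})ᗮ.orthogonalProjectionOnto with hπ
  have hπlip : LipschitzWith 1 π := Submodule.lipschitzWith_orthogonalProjectionOnto _
  have hheight : ∀ x z : Rn n, |inner ℝ e x - inner ℝ e z| ≤ dist x z := fun x z => by
    rw [← inner_sub_right, dist_eq_norm]
    simpa [he] using abs_real_inner_le_norm e (x - z)
  have hγ : ∀ y z, |γ y - γ z| ≤ L * dist y z := fun y z => by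
    simpa [Real.dist_eq] using hL.dist_le_mul y z
  have hcπ : Continuous fun x => γ (π x) := hL.continuous.comp hπlip.continuous
  have hcH : Continuous fun x : Rn n => (inner ℝ e x : ℝ) := by fun_prop
  -- The point `x₀` is on the graph: it is a limit of points above the graph, and not itself above
  -- it.
  have hxγ : γ (π x₀) = inner ℝ e x₀ := by
    refine le_antisymm ?_ (not_lt.1 fun h => hx₀.2 ((hUγ x₀ hxU).2 h))
    have hc : x₀ ∈ closure (U ∩ Ω) := hU.inter_closure ⟨hxU, hx₀.1⟩
    exact closure_minimal (fun y hy => ((hUγ y hy.1).1 hy.2).le) (isClosed_le hcπ hcH) hc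
  have hL0 : (0 : ℝ) ≤ L := L.2
  -- A point over `ball (π x₀) ρ`, at height less than `(L + 1) * ρ` above the graph, is within `ρ +
  -- (L + 1) * ρ + L * ρ ≤ R` of `x₀`. Points within `2 * ρ` of `x₀` also stay in `U`.
  set ρ : ℝ := R / (2 * L + 3) with hρ
  have hρ0 : 0 < ρ := by positivity
  have hρR : ρ * (2 * L + 3) = R := by rw [hρ]; field_simp
  have hD : ∀ y ∈ Metric.ball (π x₀) ρ, ∀ s, γ y ≤ s → s < γ y + (L + 1) * ρ →
      (y : Rn n) + s • e ∈ U := by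
    intro y hy s hs1 hs2
    apply hRU
    have h0 := orthogonalProjectionOnto_add_inner_smul he x₀
    rw [← hπ] at h0
    have hy' : dist y (π x₀) < ρ := hy
    have h1 := abs_le.1 (hγ y (π x₀))
    have h2 : (L : ℝ) * dist y (π x₀) ≤ L * ρ := by gcongr
    have h3 : |s - inner ℝ e x₀| < (L + 1) * ρ + L * ρ := by
      rw [abs_lt]; constructor <;> nlinarith
    have h4 : (y : Rn n) + s • e - x₀ = ((y - π x₀ : (Submodule.span ℝ {e})ᗮ) : Rn n)
        + (s - inner ℝ e x₀) • e := by
      rw [sub_smul]; nth_rewrite 1 [← h0]; push_cast; abel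
    rw [Metric.mem_ball, dist_eq_norm, h4]
    calc _ ≤ ‖((y - π x₀ : (Submodule.span ℝ {e})ᗮ) : Rn n)‖ + ‖(s - inner ℝ e x₀) • e‖ :=
          norm_add_le _ _
      _ < ρ + ((L + 1) * ρ + L * ρ) := by
          rw [norm_smul, he, mul_one, Real.norm_eq_abs, Submodule.norm_coe, ← dist_eq_norm]
          gcongr
      _ ≤ R := by rw [← hρR]; nlinarith
  have hin : ∀ y ∈ Metric.ball (π x₀) ρ, ∀ s, γ y < s → s < γ y + (L + 1) * ρ →
      (y : Rn n) + s • e ∈ Ω := fun y hy s hs1 hs2 => by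
    rw [hUγ _ (hD y hy s hs1.le hs2), orthogonalProjectionOnto_add_smul,
      inner_add_smul_self he]
    exact hs1
  refine ⟨e, he, γ, hL.continuous, L, ρ, Metric.ball (π x₀) ρ, hρ0, measurableSet_ball, ?_, ?_⟩
  · intro y hy
    constructor
    · have hc : Tendsto (fun s : ℝ => (y : Rn n) + s • e) (𝓝[>] (γ y)) (𝓝 (graphPoint e γ y)) := by
        refine Tendsto.mono_left (Continuous.tendsto (by fun_prop) (γ y)) nhdsWithin_le_nhds
      refine mem_closure_of_tendsto hc ?_
      filter_upwards [Ioo_mem_nhdsGT (show γ y < γ y + (L + 1) * ρ by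
        have : 0 < (L + 1) * ρ := by positivity
        linarith)] with s hs
      exact hin y hy s hs.1 hs.2
    · intro h
      have h1 := (hUγ _ (hD y hy (γ y) le_rfl (by
        have : 0 < (L + 1) * ρ := by positivity
        linarith))).1 h
      rw [orthogonalProjectionOnto_add_smul, inner_add_smul_self he] at h1
      exact lt_irrefl _ h1
  · intro t ht htρ
    refine ⟨fun y hy s hs => hin y hy s hs.1 (hs.2.trans (by gcongr)), ?_⟩
    rintro y s ⟨hst, hsb⟩
    set x : Rn n := y + s • e with hx
    have hπx : π x = y := orthogonalProjectionOnto_add_smul e y s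
    have hhx : inner ℝ e x = s := inner_add_smul_self he y s
    have hb : dist x x₀ < ρ := hsb
    have hπd : ∀ x z, dist (π x) (π z) ≤ dist x z := fun x z => by
      simpa using hπlip.dist_le_mul x z
    have hxU' : x ∈ U := hRU (by rw [Metric.mem_ball]; nlinarith)
    -- The boundary point `z` within `t` of `x` is not above the graph. Passing from `z` to `x`
    -- changes the height by less than `t` and the value of `γ` by at most `L * t`; hence the factor
    -- `L + 1`.
    obtain ⟨z, hz, hxz⟩ := exists_frontier_dist_lt hopen hne hst
    rw [hfront] at hz
    have hzU : z ∈ U := hRU (by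
      rw [Metric.mem_ball]
      have := dist_triangle_left z x₀ x
      nlinarith)
    have h1 : inner ℝ e z ≤ γ (π z) := not_lt.1 fun h => hz.2 ((hUγ z hzU).2 h)
    have h2 := (hUγ x hxU').1 hst.1
    rw [hπx, hhx] at h2
    have h3 := hheight x z
    rw [hhx] at h3
    have h4 := hγ (π z) y
    have h5 : dist (π z) y ≤ dist x z := by rw [← hπx, dist_comm x z]; exact hπd z x
    have h6 : (L : ℝ) * dist (π z) y ≤ L * t := by gcongr; exact h5.trans hxz.le
    have h7 := abs_le.1 h3
    have h8 := abs_le.1 h4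
    refine ⟨?_, h2, by nlinarith⟩
    rw [Metric.mem_ball, ← hπx]
    exact (hπd x x₀).trans_lt hb

/-- Boundary strip estimate near a boundary point. -/
lemma exists_lintegral_strip_inter_ball_le (hn : 1 ≤ n) {Ω : Set (Rn n)}
    (hΩ : IsBoundedLipschitzDomain Ω) (hne : Ωᶜ.Nonempty) {x₀ : Rn n} (hx₀ : x₀ ∈ frontier Ω) :
    ∃ (C : ℝ≥0) (ρ : ℝ), 0 < ρ ∧ ∀ t, 0 < t → t < ρ → ∀ φ : Rn n → ℝ, ContDiff ℝ 1 φ →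
      ∫⁻ x in strip Ω t ∩ Metric.ball x₀ ρ, ‖φ x‖ₑ ^ 2 ≤
        C * (ENNReal.ofReal t * ∫⁻ x, ‖φ x‖ₑ ^ 2 ∂(surfaceMeasure Ω)
          + ENNReal.ofReal t ^ 2 * ∫⁻ x in Ω, ‖fderiv ℝ φ x‖ₑ ^ 2) := by
  obtain ⟨e, he, γ, hγ, L, ρ, D, hρ, hDm, hfr, hst⟩ := exists_graph_near hΩ hne hx₀
  -- Segments of length `T = (L + 1) * t` give the coefficients `2 * T` and `2 * T ^ 2`; the first
  -- is absorbed by `L + 1 ≤ (L + 1) ^ 2`.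
  refine ⟨2 * (L + 1) ^ 2, ρ, hρ, fun t ht htρ φ hφ => ?_⟩
  obtain ⟨hin, hout⟩ := hst t ht htρ
  set T : ℝ := (L + 1) * t with hT
  have hTo : ENNReal.ofReal T = (L + 1 : ℝ≥0) * ENNReal.ofReal t := by
    rw [hT, ENNReal.ofReal_mul (by positivity)]
    congr 1
    rw [← ENNReal.ofReal_coe_nnreal]; simp
  have hfd : Continuous (fderiv ℝ φ) := hφ.continuous_fderiv one_ne_zero
  have hm1 : Measurable fun x => ‖φ x‖ₑ ^ 2 := (hφ.continuous.enorm.measurable).pow_const 2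
  have hm2 : Measurable fun x => ‖fderiv ℝ φ x‖ₑ ^ 2 := (hfd.enorm.measurable).pow_const 2
  have hSm : MeasurableSet (strip Ω t ∩ Metric.ball x₀ ρ) :=
    ((isOpen_strip hΩ.isOpen t).inter Metric.isOpen_ball).measurableSet
  have hline : ∀ y : (Submodule.span ℝ {e})ᗮ, ∫⁻ s in Ioo (γ y) (γ y + T), ‖φ (y + s • e)‖ₑ ^ 2 ≤
      2 * ENNReal.ofReal T * ‖φ (graphPoint e γ y)‖ₑ ^ 2 + 2 * ENNReal.ofReal T ^ 2 *
        ∫⁻ s in Ioo (γ y) (γ y + T), ‖fderiv ℝ φ (y + s • e)‖ₑ ^ 2 := by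
    intro y
    have hc : ContDiff ℝ 1 fun s : ℝ => φ (y + s • e) := by fun_prop
    refine (lintegral_Ioo_sq_le hc (γ y) T).trans ?_
    unfold graphPoint
    gcongr with s
    have hd : HasDerivAt (fun s : ℝ => (y : Rn n) + s • e) e s := by
      simpa using ((hasDerivAt_id s).smul_const e).const_add (y : Rn n)
    have hd2 := ((hφ.differentiable one_ne_zero) (y + s • e)).hasFDerivAt.comp_hasDerivAt s hd
    have hd3 : deriv (fun s : ℝ => φ (y + s • e)) s = fderiv ℝ φ (y + s • e) e := hd2.deriv
    rw [hd3]
    have := (fderiv ℝ φ (y + s • e)).le_opNorm e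
    rw [he, mul_one] at this
    rw [enorm_eq_nnnorm, enorm_eq_nnnorm]
    exact_mod_cast this
  calc ∫⁻ x in strip Ω t ∩ Metric.ball x₀ ρ, ‖φ x‖ₑ ^ 2
      = ∫⁻ y : (Submodule.span ℝ {e})ᗮ, ∫⁻ s : ℝ,
          (strip Ω t ∩ Metric.ball x₀ ρ).indicator (fun x => ‖φ x‖ₑ ^ 2) (y + s • e) := by
        rw [← lintegral_indicator hSm, lintegral_eq_lintegral_orthogonal he (hm1.indicator hSm)]
    _ ≤ ∫⁻ y in D, ∫⁻ s in Ioo (γ y) (γ y + T), ‖φ (y + s • e)‖ₑ ^ 2 := by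
        rw [← lintegral_indicator hDm]
        refine lintegral_mono fun y => ?_
        by_cases hy : y ∈ D
        · rw [indicator_of_mem hy, ← lintegral_indicator measurableSet_Ioo]
          refine lintegral_mono fun s => ?_
          by_cases hs : (y : Rn n) + s • e ∈ strip Ω t ∩ Metric.ball x₀ ρ
          · rw [indicator_of_mem hs, indicator_of_mem (hout y s hs).2]
          · rw [indicator_of_notMem hs]
            exact zero_le
        · refine (lintegral_eq_zero_of_ae_eq_zero (Eventually.of_forall fun s => ?_)).le.trans
            zero_le
          exact indicator_of_notMem (fun h => hy (hout y s h).1) _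
    _ ≤ ∫⁻ y in D, (2 * ENNReal.ofReal T * ‖φ (graphPoint e γ y)‖ₑ ^ 2 +
          2 * ENNReal.ofReal T ^ 2 *
            ∫⁻ s in Ioo (γ y) (γ y + T), ‖fderiv ℝ φ (y + s • e)‖ₑ ^ 2) :=
        lintegral_mono fun y => hline y
    _ = 2 * ENNReal.ofReal T * (∫⁻ y in D, ‖φ (graphPoint e γ y)‖ₑ ^ 2) +
          2 * ENNReal.ofReal T ^ 2 *
            ∫⁻ y in D, ∫⁻ s in Ioo (γ y) (γ y + T), ‖fderiv ℝ φ (y + s • e)‖ₑ ^ 2 := by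
        have hΓ : Measurable (graphPoint e γ) := by
          unfold graphPoint
          exact (continuous_subtype_val.add (hγ.smul continuous_const)).measurable
        have hmΓ : Measurable fun y => ‖φ (graphPoint e γ y)‖ₑ ^ 2 := hm1.comp hΓ
        rw [lintegral_add_left (hmΓ.const_mul _), lintegral_const_mul _ hmΓ,
          lintegral_const_mul' _ _ (by finiteness)]
    _ ≤ 2 * ENNReal.ofReal T * ∫⁻ x, ‖φ x‖ₑ ^ 2 ∂(surfaceMeasure Ω) +
          2 * ENNReal.ofReal T ^ 2 * ∫⁻ x in Ω, ‖fderiv ℝ φ x‖ₑ ^ 2 := by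
        gcongr 2 * ENNReal.ofReal T * ?_ + 2 * ENNReal.ofReal T ^ 2 * ?_
        · exact setLIntegral_graphPoint_le hn he hγ hfr hm1
        -- By `hin` the transversal segments stay inside `Ω`, so Fubini in reverse bounds the
        -- gradient term by an integral over `Ω`.
        · have hΩm := hΩ.isOpen.measurableSet
          rw [← lintegral_indicator hΩm,
            lintegral_eq_lintegral_orthogonal he (hm2.indicator hΩm)]
          refine (setLIntegral_mono' hDm fun y hy => ?_).trans (setLIntegral_le_lintegral D _)
          refine (setLIntegral_mono' measurableSet_Ioo fun s hs => ?_).trans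
            (setLIntegral_le_lintegral (Ioo (γ y) (γ y + T)) _)
          rw [indicator_of_mem (hin y hy s hs)]
    _ ≤ _ := by
        rw [hTo, mul_add]
        have h1 : (1 : ℝ≥0∞) ≤ (L + 1 : ℝ≥0) := by
          exact_mod_cast (le_add_self : (1 : ℝ≥0) ≤ L + 1)
        push_cast at h1 ⊢
        gcongr ?_ + ?_
        · rw [← mul_assoc, ← mul_assoc]
          gcongr ?_ * _ * _
          gcongr
          exact le_self_pow₀ h1 two_ne_zero
        · exact le_of_eq (by ring)

/-- Needs `1 ≤ n`, since `ℝ⁰` is itself bounded. A nonempty complement makes `Metric.infDist` a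
genuine distance rather than its default value `0`. -/
lemma compl_nonempty_of_isBounded (hn : 1 ≤ n) {Ω : Set (Rn n)} (hΩ : Bornology.IsBounded Ω) :
    Ωᶜ.Nonempty := by
  have : Nonempty (Fin n) := ⟨⟨0, hn⟩⟩
  by_contra h
  rw [not_nonempty_iff_eq_empty, compl_empty_iff] at h
  exact NormedSpace.unbounded_univ ℝ (Rn n) (h ▸ hΩ)

/-- Boundary strip estimate. -/
lemma exists_lintegral_strip_le (hn : 1 ≤ n) {Ω : Set (Rn n)} (hΩ : IsBoundedLipschitzDomain Ω) :
    ∃ (C : ℝ≥0) (ρ : ℝ), 0 < ρ ∧ ∀ t, 0 < t → t < ρ → ∀ φ : Rn n → ℝ, ContDiff ℝ 1 φ →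
      ∫⁻ x in strip Ω t, ‖φ x‖ₑ ^ 2 ≤
        C * (ENNReal.ofReal t * ∫⁻ x, ‖φ x‖ₑ ^ 2 ∂(surfaceMeasure Ω)
          + ENNReal.ofReal t ^ 2 * ∫⁻ x in Ω, ‖fderiv ℝ φ x‖ₑ ^ 2) := by
  have hne := compl_nonempty_of_isBounded hn hΩ.isBounded
  have hK : IsCompact (frontier Ω) :=
    Metric.isCompact_of_isClosed_isBounded isClosed_frontier
      (hΩ.isBounded.closure.subset frontier_subset_closure)
  -- The estimate on `strip Ω t ∩ W` survives finite unions of the sets `W` (constants add, radii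
  -- take the minimum), so compactness of the boundary makes it global.
  have key : ∃ (C : ℝ≥0) (ρ : ℝ) (W : Set (Rn n)), 0 < ρ ∧ IsOpen W ∧ frontier Ω ⊆ W ∧
      ∀ t, 0 < t → t < ρ → ∀ φ : Rn n → ℝ, ContDiff ℝ 1 φ →
      ∫⁻ x in strip Ω t ∩ W, ‖φ x‖ₑ ^ 2 ≤
        C * (ENNReal.ofReal t * ∫⁻ x, ‖φ x‖ₑ ^ 2 ∂(surfaceMeasure Ω)
          + ENNReal.ofReal t ^ 2 * ∫⁻ x in Ω, ‖fderiv ℝ φ x‖ₑ ^ 2) := by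
    refine hK.induction_on (p := fun s => ∃ (C : ℝ≥0) (ρ : ℝ) (W : Set (Rn n)), 0 < ρ ∧ IsOpen W ∧
      s ⊆ W ∧ ∀ t, 0 < t → t < ρ → ∀ φ : Rn n → ℝ, ContDiff ℝ 1 φ →
      ∫⁻ x in strip Ω t ∩ W, ‖φ x‖ₑ ^ 2 ≤
        C * (ENNReal.ofReal t * ∫⁻ x, ‖φ x‖ₑ ^ 2 ∂(surfaceMeasure Ω)
          + ENNReal.ofReal t ^ 2 * ∫⁻ x in Ω, ‖fderiv ℝ φ x‖ₑ ^ 2)) ?_ ?_ ?_ ?_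
    · exact ⟨0, 1, ∅, one_pos, isOpen_empty, subset_rfl, by simp⟩
    · rintro s s' hs ⟨C, ρ, W, h1, h2, h3, h4⟩
      exact ⟨C, ρ, W, h1, h2, hs.trans h3, h4⟩
    · rintro s s' ⟨C, ρ, W, h1, h2, h3, h4⟩ ⟨C', ρ', W', h1', h2', h3', h4'⟩
      refine ⟨C + C', min ρ ρ', W ∪ W', lt_min h1 h1', h2.union h2', union_subset_union h3 h3',
        fun t ht htρ φ hφ => ?_⟩
      rw [inter_union_distrib_left]
      refine (lintegral_union_le _ _ _).trans ?_
      push_cast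
      rw [add_mul]
      exact add_le_add (h4 t ht (htρ.trans_le (min_le_left _ _)) φ hφ)
        (h4' t ht (htρ.trans_le (min_le_right _ _)) φ hφ)
    · intro x hx
      obtain ⟨C, ρ, hρ, h⟩ := exists_lintegral_strip_inter_ball_le hn hΩ hne hx
      exact ⟨Metric.ball x ρ, mem_nhdsWithin_of_mem_nhds (Metric.ball_mem_nhds x hρ),
        C, ρ, Metric.ball x ρ, hρ, Metric.isOpen_ball, subset_rfl, h⟩
  obtain ⟨C, ρ, W, hρ, hW, hfW, h⟩ := key
  obtain ⟨δ, hδ, hδW⟩ := hK.exists_thickening_subset_open hW hfW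
  refine ⟨C, min ρ δ, lt_min hρ hδ, fun t ht htρ φ hφ => ?_⟩
  have hsub : strip Ω t ⊆ W := fun x hx => by
    obtain ⟨z, hz, hxz⟩ := exists_frontier_dist_lt hΩ.isOpen hne hx
    exact hδW (Metric.mem_thickening_iff.2
      ⟨z, hz, hxz.trans (htρ.trans_le (min_le_right _ _))⟩)
  have := h t ht (htρ.trans_le (min_le_left _ _)) φ hφ
  rwa [inter_eq_self_of_subset_left hsub] at this

/-! ### Smooth cutoff functions. -/

/-- Mollification of a Lipschitz function with values in `[0, 1]`. -/
lemma exists_contDiff_of_lipschitz {g : Rn n → ℝ} {K : ℝ≥0} (hg : LipschitzWith K g)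
    (h0 : ∀ x, 0 ≤ g x) (h1 : ∀ x, g x ≤ 1) {r : ℝ} (hr : 0 < r) :
    ∃ η : Rn n → ℝ, ContDiff ℝ ∞ η ∧ (∀ x, 0 ≤ η x) ∧ (∀ x, η x ≤ 1) ∧ LipschitzWith K η ∧
      ∀ x, (∀ y ∈ Metric.ball x r, g y = g x) → η x = g x := by
  -- Convolution with a probability density supported in radius `r` averages translates of `g`:
  -- bounds and Lipschitz constant persist, and so do values where `g` is constant on the `r`-ball.
  let ρ : ContDiffBump (0 : Rn n) := ⟨r / 2, r, by positivity, by linarith⟩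
  have hρc : HasCompactSupport (ρ.normed volume) := ρ.hasCompactSupport_normed
  have hint : ∀ x, Integrable fun y => ρ.normed volume y * g (x - y) := fun x =>
    (ρ.continuous_normed.mul (hg.continuous.comp (by fun_prop))).integrable_of_hasCompactSupport
      hρc.mul_right
  have hρ0 : ∀ y, 0 ≤ ρ.normed volume y := fun y => ρ.nonneg_normed y
  have hρ1 : ∫ y, ρ.normed volume y = 1 := ρ.integral_normed
  have hρi : Integrable (ρ.normed volume) := ρ.integrable_normed
  have heq : ∀ x, (MeasureTheory.convolution (ρ.normed volume) g
      (ContinuousLinearMap.lsmul ℝ ℝ) volume) x = ∫ y, ρ.normed volume y * g (x - y) :=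
    fun x => by simp [MeasureTheory.convolution_def]
  refine ⟨MeasureTheory.convolution (ρ.normed volume) g (ContinuousLinearMap.lsmul ℝ ℝ) volume,
    ?_, fun x => ?_, fun x => ?_, ?_, fun x hx => ?_⟩
  · exact hρc.contDiff_convolution_left _ ρ.contDiff_normed hg.continuous.locallyIntegrable
  · rw [heq]
    exact integral_nonneg fun y => mul_nonneg (hρ0 y) (h0 _)
  · rw [heq, ← hρ1]
    exact integral_mono (hint x) hρi fun y => mul_le_of_le_one_right (hρ0 y) (h1 _)
  · refine LipschitzWith.of_dist_le_mul fun x z => ?_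
    rw [heq, heq, Real.dist_eq, ← integral_sub (hint x) (hint z), ← Real.norm_eq_abs]
    calc _ ≤ ∫ y, ρ.normed volume y * (K * dist x z) := by
          refine norm_integral_le_of_norm_le (hρi.mul_const _) (Eventually.of_forall fun y => ?_)
          rw [← mul_sub, norm_mul, Real.norm_of_nonneg (hρ0 y)]
          gcongr
          · exact hρ0 y
          · have := hg.dist_le_mul (x - y) (z - y)
            rwa [Real.dist_eq, dist_sub_right] at this
      _ = _ := by rw [integral_mul_const, hρ1, one_mul]
  · exact ContDiffBump.normed_convolution_eq_right hx

/-- Smooth cutoff functions, equal to `1` off the strip of width `t`, with gradient `O(1 / t)`. -/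
lemma exists_cutoff {Ω : Set (Rn n)} (hΩ : Bornology.IsBounded Ω) {t : ℝ}
    (ht : 0 < t) : ∃ η : Rn n → ℝ, ContDiff ℝ ∞ η ∧ (∀ x, 0 ≤ η x) ∧ (∀ x, η x ≤ 1) ∧
      (∀ x, ‖fderiv ℝ η x‖ ≤ 4 / t) ∧ HasCompactSupport η ∧ tsupport η ⊆ Ω ∧
      ∀ x ∈ Ω \ strip Ω t, η x = 1 := by
  set d : Rn n → ℝ := fun x => Metric.infDist x Ωᶜ with hd
  have hdl : ∀ x y, d x ≤ d y + dist x y := fun x y => Metric.infDist_le_infDist_add_dist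
  -- A profile of slope `4 / t`, equal to `0` for `d ≤ t / 2` and to `1` for `d ≥ 3 * t / 4`.
  -- Mollified at scale `t / 4`, it vanishes for `d < t / 4` and equals `1` for `d ≥ t`.
  set g : Rn n → ℝ := fun x => min 1 (max 0 (4 / t * d x - 2)) with hg
  have hlip : LipschitzWith (4 / t).toNNReal g := by
    have h1 : LipschitzWith (4 / t).toNNReal fun x => 4 / t * d x - 2 := by
      refine LipschitzWith.of_dist_le_mul fun x y => ?_
      have h3 : |d x - d y| ≤ dist x y := abs_le.2 ⟨by have := hdl y x; rw [dist_comm] at this; linarith,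
        by have := hdl x y; linarith⟩
      rw [Real.dist_eq, sub_sub_sub_cancel_right, ← mul_sub, abs_mul, abs_of_pos (by positivity),
        Real.coe_toNNReal _ (by positivity)]
      exact mul_le_mul_of_nonneg_left h3 (by positivity)
    exact (h1.const_max 0).const_min 1
  have ht4 : 0 < t / 4 := by positivity
  obtain ⟨η, hη, hη0, hη1, hηl, hηg⟩ := exists_contDiff_of_lipschitz hlip
    (fun x => le_min zero_le_one (le_max_left _ _)) (fun x => min_le_left _ _) ht4
  have hg0 : ∀ x, d x ≤ t / 2 → g x = 0 := fun x hx => by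
    have : 4 / t * d x - 2 ≤ 0 := by
      calc 4 / t * d x - 2 ≤ 4 / t * (t / 2) - 2 := by gcongr
        _ = 0 := by field_simp; norm_num
    rw [hg]; simp [max_eq_left this]
  have hg1 : ∀ x, 3 * t / 4 ≤ d x → g x = 1 := fun x hx => by
    have : 1 ≤ 4 / t * d x - 2 := by
      calc (1 : ℝ) = 4 / t * (3 * t / 4) - 2 := by field_simp; norm_num
        _ ≤ _ := by gcongr
    rw [hg]; simp [this]
  have hη1' : ∀ x, t ≤ d x → η x = 1 := fun x hx => by
    rw [hηg x, hg1 x (by linarith)]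
    intro y hy
    have h1 := hdl x y
    rw [Metric.mem_ball, dist_comm] at hy
    rw [hg1 x (by linarith), hg1 y (by linarith)]
  have hsupp : Function.support η ⊆ {x | t / 4 ≤ d x} := fun x hx => by
    by_contra h
    rw [mem_ofPred_eq, not_le] at h
    refine hx ?_
    rw [hηg x, hg0 x (by linarith)]
    intro y hy
    have h1 := hdl y x
    rw [Metric.mem_ball] at hy
    rw [hg0 x (by linarith), hg0 y (by linarith)]
  have hcl : IsClosed {x | t / 4 ≤ d x} :=
    isClosed_le continuous_const (Metric.continuous_infDist_pt _)
  have hin : {x | t / 4 ≤ d x} ⊆ Ω := fun x hx => by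
    by_contra h
    have h0 : d x = 0 := Metric.infDist_zero_of_mem h
    rw [mem_ofPred_eq, h0] at hx
    linarith
  have htsupp : tsupport η ⊆ {x | t / 4 ≤ d x} := closure_minimal hsupp hcl
  refine ⟨η, hη, hη0, hη1, fun x => ?_, ?_, htsupp.trans hin, fun x hx => ?_⟩
  · refine (norm_fderiv_le_of_lipschitz ℝ hηl).trans ?_
    rw [Real.coe_toNNReal _ (by positivity)]
  · exact Metric.isCompact_of_isClosed_isBounded (isClosed_tsupport η)
      (hΩ.subset (htsupp.trans hin))
  · exact hη1' x (not_lt.1 fun h => hx.2 ⟨hx.1, h⟩)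

/-! ### Tools for `L²` limits. -/

section Auxiliary

variable {α : Type*} [MeasurableSpace α]

lemma eLpNorm_two_sq {E : Type*} [NormedAddCommGroup E] (μ : Measure α) (f : α → E) :
    eLpNorm f 2 μ ^ 2 = ∫⁻ x, ‖f x‖ₑ ^ 2 ∂μ := by
  have h := eLpNorm_nnreal_pow_eq_lintegral (μ := μ) (f := f) (p := 2) two_ne_zero
  simpa using h

lemma lintegral_enorm_mul_enorm_le (μ : Measure α) {a b : α → ℝ}
    (ha : AEStronglyMeasurable a μ) (hb : AEStronglyMeasurable b μ) :
    ∫⁻ x, ‖a x‖ₑ * ‖b x‖ₑ ∂μ ≤ eLpNorm a 2 μ * eLpNorm b 2 μ := by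
  have h := ENNReal.lintegral_mul_le_Lp_mul_Lq μ Real.HolderConjugate.two_two
    (f := fun x => ‖a x‖ₑ) (g := fun x => ‖b x‖ₑ) ha.enorm hb.enorm
  simpa [eLpNorm_eq_lintegral_rpow_enorm_toReal two_ne_zero ENNReal.ofNat_ne_top] using h

lemma enorm_integral_mul_le (μ : Measure α) {a b : α → ℝ}
    (ha : AEStronglyMeasurable a μ) (hb : AEStronglyMeasurable b μ) :
    ‖∫ x, a x * b x ∂μ‖ₑ ≤ eLpNorm a 2 μ * eLpNorm b 2 μ := by
  refine (enorm_integral_le_lintegral_enorm _).trans ?_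
  simp_rw [enorm_mul]
  exact lintegral_enorm_mul_enorm_le μ ha hb

lemma tendsto_zero_of_sq_tendsto_zero {ι : Type*} {l : Filter ι} {a : ι → ℝ≥0∞}
    (h : Tendsto (fun m => a m ^ 2) l (𝓝 0)) : Tendsto a l (𝓝 0) := by
  have h5 := ((ENNReal.continuous_rpow_const (y := (1 / 2 : ℝ))).tendsto _).comp h
  simp only [ENNReal.zero_rpow_of_pos (show (0 : ℝ) < 1 / 2 by norm_num)] at h5
  refine h5.congr fun m => ?_
  simp only [Function.comp]
  rw [← ENNReal.rpow_natCast, ← ENNReal.rpow_mul]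
  norm_num

/-- Dominated convergence in `L²`. -/
lemma tendsto_eLpNorm_sub_of_dominated {μ : Measure α} {F : ℕ → α → ℝ} {f h : α → ℝ}
    (hF : ∀ m, AEStronglyMeasurable (F m) μ) (hf : AEStronglyMeasurable f μ) (hh : MemLp h 2 μ)
    (hbound : ∀ m, ∀ᵐ x ∂μ, |F m x - f x| ≤ |h x|)
    (hlim : ∀ᵐ x ∂μ, Tendsto (fun m => F m x) atTop (𝓝 (f x))) :
    Tendsto (fun m => eLpNorm (fun x => F m x - f x) 2 μ) atTop (𝓝 0) := by
  refine tendsto_zero_of_sq_tendsto_zero ?_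
  simp_rw [eLpNorm_two_sq]
  have hfin : ∫⁻ x, ‖h x‖ₑ ^ 2 ∂μ ≠ ⊤ := by
    rw [← eLpNorm_two_sq]; exact ENNReal.pow_ne_top hh.2.ne
  have key := tendsto_lintegral_of_dominated_convergence' (μ := μ)
    (F := fun m x => ‖F m x - f x‖ₑ ^ 2) (f := fun _ => 0) (fun x => ‖h x‖ₑ ^ 2)
    (fun m => ((hF m).sub hf).enorm.pow_const 2) ?_ hfin ?_
  · simpa using key
  · intro m
    filter_upwards [hbound m] with x hx
    gcongr
    exact enorm_le_iff_norm_le.2 hx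
  · filter_upwards [hlim] with x hx
    have h1 : Tendsto (fun m => ‖F m x - f x‖ₑ) atTop (𝓝 ‖f x - f x‖ₑ) :=
      (hx.sub_const (f x)).enorm
    have h2 := (ENNReal.continuous_pow 2).tendsto _ |>.comp h1
    simpa [Function.comp_def] using h2

/-- This closes the density arguments: an identity holds up to `ε` times a fixed finite constant.
The restriction `ε < 1` lets the approximants inherit square integrability. -/
lemma eq_zero_of_enorm_le_mul {x : ℝ} {K : ℝ≥0∞} (hK : K ≠ ⊤)
    (h : ∀ ε : ℝ≥0∞, 0 < ε → ε < 1 → ‖x‖ₑ ≤ ε * K) : x = 0 := by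
  have hlim : Tendsto (fun ε : ℝ≥0∞ => ε * K) (𝓝[>] 0) (𝓝 (0 * K)) :=
    (ENNReal.Tendsto.mul_const tendsto_id (Or.inr hK)).mono_left nhdsWithin_le_nhds
  have hle : ‖x‖ₑ ≤ 0 * K := ge_of_tendsto hlim (by
    filter_upwards [Ioo_mem_nhdsGT one_pos] with ε hε
    exact h ε hε.1 hε.2)
  simpa using hle

end Auxiliary

/-! ### Functions approximated by smooth ones together with gradient and trace. -/

instance isFiniteMeasureOnCompacts_volOn (Ω : Set (Rn n)) :
    IsFiniteMeasureOnCompacts (volOn Ω) :=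
  inferInstanceAs (IsFiniteMeasureOnCompacts (volume.restrict Ω))

lemma MemL2.integrable_mul {Ω : Set (Rn n)} {a b : Rn n → ℝ} (ha : MemL2 Ω a) (hb : MemL2 Ω b) :
    Integrable (fun x => a x * b x) (volume.restrict Ω) :=
  MemLp.integrable_mul ha hb

/-- `u ∈ L²(Ω)` with `G ∈ L²(Ω)ⁿ`, and some smooth functions approximate simultaneously `u` and `G`
(by their gradients) in `L²(Ω)`, and `g` in `L²(∂Ω)`. -/
structure SmoothApprox (Ω : Set (Rn n)) (u : Rn n → ℝ) (G : Fin n → Rn n → ℝ)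
    (g : Rn n → ℝ) : Prop where
  memL2 : MemL2 Ω u
  grad_memL2 : ∀ i, MemL2 Ω (G i)
  memLp_trace : MemLp g 2 (surfaceMeasure Ω)
  approx : ∀ ε : ℝ≥0∞, 0 < ε → ∃ φ : Rn n → ℝ, ContDiff ℝ ∞ φ ∧
    eLpNorm (fun x => φ x - u x) 2 (volOn Ω) ≤ ε ∧
    (∀ i, eLpNorm (fun x => partialDeriv i φ x - G i x) 2 (volOn Ω) ≤ ε) ∧
    eLpNorm (fun x => φ x - g x) 2 (surfaceMeasure Ω) ≤ ε

lemma continuous_partialDeriv {φ : Rn n → ℝ} (hφ : ContDiff ℝ ∞ φ) (i : Fin n) :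
    Continuous (partialDeriv i φ) :=
  (hφ.continuous_fderiv (by simp)).clm_apply continuous_const

lemma hasCompactSupport_partialDeriv {φ : Rn n → ℝ} (hφ : HasCompactSupport φ) (i : Fin n) :
    HasCompactSupport (partialDeriv i φ) := hφ.fderiv_apply ℝ _

lemma partialDeriv_eq_zero_of_notMem {φ : Rn n → ℝ} {i : Fin n} {x : Rn n} (hx : x ∉ tsupport φ) :
    partialDeriv i φ x = 0 := by
  have h : fderiv ℝ φ x = 0 := by
    by_contra h
    exact hx (support_fderiv_subset ℝ h)
  simp [partialDeriv, h]

/-- A smooth function has its classical partial derivatives as weak partial derivatives. -/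
lemma hasWeakPartial_partialDeriv (Ω : Set (Rn n)) {φ : Rn n → ℝ} (hφ : ContDiff ℝ ∞ φ)
    (i : Fin n) : HasWeakPartial Ω i φ (partialDeriv i φ) := by
  intro χ hχ hχc hχΩ
  have hχ0 : ∀ x ∉ Ω, χ x = 0 := fun x hx => image_eq_zero_of_notMem_tsupport fun h => hx (hχΩ h)
  rw [setIntegral_eq_integral_of_forall_compl_eq_zero
      fun x hx => by rw [partialDeriv_eq_zero_of_notMem fun h => hx (hχΩ h), mul_zero],
    setIntegral_eq_integral_of_forall_compl_eq_zero fun x hx => by rw [hχ0 x hx, mul_zero]]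
  have hdχ := hasCompactSupport_partialDeriv hχc i
  refine integral_mul_fderiv_eq_neg_fderiv_mul_of_integrable ?_ ?_ ?_
    (fun x _ => (hφ.differentiable (by simp)).differentiableAt)
    (fun x _ => (hχ.differentiable (by simp)).differentiableAt)
  · exact ((continuous_partialDeriv hφ i).mul hχ.continuous).integrable_of_hasCompactSupport
      hχc.mul_left
  · exact (hφ.continuous.mul (continuous_partialDeriv hχ i)).integrable_of_hasCompactSupport
      hdχ.mul_left
  · exact (hφ.continuous.mul hχ.continuous).integrable_of_hasCompactSupport hχc.mul_left

lemma memLp_of_eLpNorm_sub_le {μ : Measure (Rn n)} {φ u : Rn n → ℝ} (hφ : Continuous φ)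
    (hu : MemLp u 2 μ) {ε : ℝ≥0∞} (hε : ε < 1) (h : eLpNorm (fun x => φ x - u x) 2 μ ≤ ε) :
    MemLp φ 2 μ := by
  have h1 : MemLp (fun x => φ x - u x) 2 μ :=
    ⟨hφ.aestronglyMeasurable.sub hu.1, h.trans_lt (hε.trans ENNReal.one_lt_top)⟩
  have h2 := h1.add hu
  refine h2.ae_eq (Eventually.of_forall fun x => ?_)
  simp

/-- Integration by parts for the smooth approximants passes to the `L²` limit, which identifies the
freely given `G` as the weak gradient. -/
lemma SmoothApprox.hasWeakPartial {Ω : Set (Rn n)} {u g : Rn n → ℝ} {G : Fin n → Rn n → ℝ}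
    (h : SmoothApprox Ω u G g) (i : Fin n) : HasWeakPartial Ω i u (G i) := by
  intro χ hχ hχc hχΩ
  have hχ2 : MemLp χ 2 (volOn Ω) := hχ.continuous.memLp_of_hasCompactSupport hχc
  have hdχ2 : MemLp (partialDeriv i χ) 2 (volOn Ω) :=
    (continuous_partialDeriv hχ i).memLp_of_hasCompactSupport (hasCompactSupport_partialDeriv hχc i)
  rw [← sub_eq_zero, sub_neg_eq_add]
  refine eq_zero_of_enorm_le_mul (K := eLpNorm (partialDeriv i χ) 2 (volOn Ω)
    + eLpNorm χ 2 (volOn Ω)) (ENNReal.add_ne_top.2 ⟨hdχ2.2.ne, hχ2.2.ne⟩) fun ε hε hε1 => ?_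
  obtain ⟨φ, hφ, h1, h2, -⟩ := h.approx ε hε
  have hφ2 := memLp_of_eLpNorm_sub_le hφ.continuous h.memL2 hε1 h1
  have hdφ2 := memLp_of_eLpNorm_sub_le (continuous_partialDeriv hφ i) (h.grad_memL2 i) hε1 (h2 i)
  have h3 := hasWeakPartial_partialDeriv Ω hφ i χ hχ hχc hχΩ
  have h4 : (∫ x in Ω, u x * partialDeriv i χ x) + ∫ x in Ω, G i x * χ x =
      -((∫ x in Ω, (φ x - u x) * partialDeriv i χ x)
        + ∫ x in Ω, (partialDeriv i φ x - G i x) * χ x) := by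
    simp_rw [sub_mul]
    rw [integral_sub (MemL2.integrable_mul hφ2 hdχ2) (MemL2.integrable_mul h.memL2 hdχ2),
      integral_sub (MemL2.integrable_mul hdφ2 hχ2) (MemL2.integrable_mul (h.grad_memL2 i) hχ2), h3]
    ring
  rw [h4, enorm_neg, mul_add]
  refine (enorm_add_le _ _).trans (add_le_add ?_ ?_)
  · refine (enorm_integral_mul_le _ (hφ2.1.sub h.memL2.1) hdχ2.1).trans ?_
    gcongr
    exact h1
  · refine (enorm_integral_mul_le _ (hdφ2.1.sub (h.grad_memL2 i).1) hχ2.1).trans ?_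
    gcongr
    exact h2 i

/-- Links the strip estimate, stated with the operator norm of the derivative, to `SmoothApprox`,
which controls partial derivatives: `‖Dφ‖ ≤ ∑ |∂ᵢφ|`. -/
lemma eLpNorm_fderiv_le {φ : Rn n → ℝ} (hφ : ContDiff ℝ ∞ φ) (μ : Measure (Rn n)) :
    eLpNorm (fderiv ℝ φ) 2 μ ≤ ∑ i, eLpNorm (partialDeriv i φ) 2 μ := by
  calc eLpNorm (fderiv ℝ φ) 2 μ ≤ eLpNorm (∑ i, fun x => ‖partialDeriv i φ x‖) 2 μ := by
        refine eLpNorm_mono_real fun x => ?_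
        rw [Finset.sum_apply]
        refine ContinuousLinearMap.opNorm_le_bound _ (Finset.sum_nonneg fun i _ => norm_nonneg _)
          fun v => ?_
        have hv : v = ∑ i, v i • EuclideanSpace.single i (1 : ℝ) := by
          conv_lhs => rw [← (EuclideanSpace.basisFun (Fin n) ℝ).sum_repr v]
          simp
        conv_lhs => rw [hv]
        rw [map_sum, Finset.sum_mul]
        refine (norm_sum_le _ _).trans (Finset.sum_le_sum fun i _ => ?_)
        rw [map_smul, norm_smul, mul_comm]
        exact mul_le_mul_of_nonneg_left (PiLp.norm_apply_le v i) (norm_nonneg _)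
    _ ≤ ∑ i, eLpNorm (fun x => ‖partialDeriv i φ x‖) 2 μ :=
        eLpNorm_sum_le (fun i _ => (continuous_partialDeriv hφ i).norm.aestronglyMeasurable)
          (by norm_num)
    _ = _ := by simp_rw [eLpNorm_norm]

/-! ### Integration by parts against functions of zero trace. -/

/-- A function with vanishing trace is `O(t)` in `L²` of the strip of width `t`. -/
lemma SmoothApprox.exists_eLpNorm_strip_le (hn : 1 ≤ n) {Ω : Set (Rn n)}
    (hΩ : IsBoundedLipschitzDomain Ω) {p : Rn n → ℝ} {P : Fin n → Rn n → ℝ}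
    (h : SmoothApprox Ω p P 0) :
    ∃ (K : ℝ≥0∞) (ρ : ℝ), K ≠ ⊤ ∧ 0 < ρ ∧ ∀ t, 0 < t → t < ρ →
      eLpNorm p 2 (volume.restrict (strip Ω t)) ≤ ENNReal.ofReal t * K := by
  obtain ⟨C, ρ, hρ, hC⟩ := exists_lintegral_strip_le hn hΩ
  set M := ∑ i, (eLpNorm (P i) 2 (volOn Ω) + 1) with hM
  have hMtop : M ≠ ⊤ := (ENNReal.sum_lt_top.2 fun i _ =>
    ENNReal.add_lt_top.2 ⟨(h.grad_memL2 i).2, ENNReal.one_lt_top⟩).ne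
  refine ⟨1 + (C + 1) * (1 + M), min ρ 1, by finiteness, lt_min hρ one_pos, fun t ht htρ => ?_⟩
  have ht1 : ENNReal.ofReal t < 1 := by
    rw [← ENNReal.ofReal_one]
    exact (ENNReal.ofReal_lt_ofReal_iff one_pos).2 (htρ.trans_le (min_le_right _ _))
  set τ := ENNReal.ofReal t with hτ
  -- The accuracy of `φ` is matched to the width `t`: the boundary term in the strip estimate is
  -- then at most `t * t ^ 2 ≤ t ^ 2`, and replacing `p` by `φ` costs at most `t`.
  obtain ⟨φ, hφ, h1, h2, h3⟩ := h.approx τ (ENNReal.ofReal_pos.2 ht)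
  have hle : volume.restrict (strip Ω t) ≤ volOn Ω :=
    Measure.restrict_mono (strip_subset Ω t) le_rfl
  have hgrad : eLpNorm (fderiv ℝ φ) 2 (volOn Ω) ≤ M := by
    refine (eLpNorm_fderiv_le hφ _).trans (Finset.sum_le_sum fun i _ => ?_)
    have : partialDeriv i φ = fun x => P i x + (partialDeriv i φ x - P i x) := by ext; ring
    rw [this]
    refine (eLpNorm_add_le (h.grad_memL2 i).1
      ((continuous_partialDeriv hφ i).aestronglyMeasurable.sub (h.grad_memL2 i).1)
      (by norm_num)).trans ?_
    gcongr
    exact (h2 i).trans ht1.le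
  have hφs : eLpNorm φ 2 (volume.restrict (strip Ω t)) ≤ τ * ((C + 1) * (1 + M)) := by
    have h4 := hC t ht (htρ.trans_le (min_le_left _ _)) φ (hφ.of_le (by simp))
    rw [← eLpNorm_two_sq, ← eLpNorm_two_sq, ← eLpNorm_two_sq] at h4
    simp only [Pi.zero_apply, sub_zero] at h3
    rw [← ENNReal.pow_le_pow_left_iff two_ne_zero]
    calc _ ≤ _ := h4
      _ ≤ C * (τ * τ ^ 2 + τ ^ 2 * M ^ 2) := by
          gcongr
          exact hgrad
      _ ≤ C * (1 * τ ^ 2 + τ ^ 2 * M ^ 2) := by gcongr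
      _ = τ ^ 2 * (C * (1 ^ 2 + M ^ 2)) := by ring
      _ ≤ τ ^ 2 * ((C + 1) ^ 2 * (1 + M) ^ 2) := by
          refine mul_le_mul' le_rfl (mul_le_mul' ?_ ?_)
          · calc (C : ℝ≥0∞) ≤ C + 1 := le_self_add
              _ ≤ _ := le_self_pow₀ le_add_self two_ne_zero
          · rw [add_sq]
            exact add_le_add le_self_add le_rfl
      _ = _ := by ring
  have hsplit : p = fun x => φ x - (φ x - p x) := by ext; ring
  have hm : AEStronglyMeasurable (fun x => φ x - p x) (volume.restrict (strip Ω t)) :=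
    (hφ.continuous.aestronglyMeasurable.sub h.memL2.1).mono_measure hle
  calc eLpNorm p 2 (volume.restrict (strip Ω t))
      ≤ eLpNorm φ 2 (volume.restrict (strip Ω t))
        + eLpNorm (fun x => φ x - p x) 2 (volume.restrict (strip Ω t)) := by
        conv_lhs => rw [hsplit]
        exact eLpNorm_sub_le hφ.continuous.aestronglyMeasurable hm (by norm_num)
    _ ≤ τ * ((C + 1) * (1 + M)) + τ := by
        gcongr
        exact (eLpNorm_mono_measure _ hle).trans h1
    _ = _ := by ring

lemma MemL2.bdd_mul {Ω : Set (Rn n)} {a η : Rn n → ℝ} (ha : MemL2 Ω a) (hη : Continuous η) {c : ℝ}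
    (hc : ∀ x, |η x| ≤ c) : MemL2 Ω (fun x => η x * a x) :=
  MemLp.of_le_mul ha (hη.aestronglyMeasurable.mul ha.1)
    (Eventually.of_forall fun x => by
      rw [norm_mul]; exact mul_le_mul_of_nonneg_right (hc x) (norm_nonneg _))

lemma eLpNorm_bdd_mul_le {μ : Measure (Rn n)} (a : Rn n → ℝ) {η : Rn n → ℝ} {c : ℝ}
    (hc : ∀ x, |η x| ≤ c) :
    eLpNorm (fun x => η x * a x) 2 μ ≤ ENNReal.ofReal c * eLpNorm a 2 μ :=
  eLpNorm_le_mul_eLpNorm_of_ae_le_mul (Eventually.of_forall fun x => by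
      rw [norm_mul]; exact mul_le_mul_of_nonneg_right (hc x) (norm_nonneg _)) 2

lemma abs_partialDeriv_le {η : Rn n → ℝ} {c : ℝ} (hc : ∀ x, ‖fderiv ℝ η x‖ ≤ c) (i : Fin n)
    (x : Rn n) : |partialDeriv i η x| ≤ c := by
  have h := (fderiv ℝ η x).le_opNorm (EuclideanSpace.single i (1 : ℝ))
  simp only [PiLp.norm_single, norm_one, mul_one] at h
  exact h.trans (hc x)

/-- A weak partial derivative may be tested against `η p`, with `η` a cutoff function and `p` a
limit of smooth functions. -/
lemma SmoothApprox.integral_cutoff {Ω : Set (Rn n)} {p c : Rn n → ℝ} {P : Fin n → Rn n → ℝ}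
    (h : SmoothApprox Ω p P c) {i : Fin n} {G g : Rn n → ℝ} (hG : MemL2 Ω G) (hg : MemL2 Ω g)
    (hGg : HasWeakPartial Ω i G g) {η : Rn n → ℝ} (hη : ContDiff ℝ ∞ η) (hη1 : ∀ x, |η x| ≤ 1)
    {K : ℝ} (hK : ∀ x, ‖fderiv ℝ η x‖ ≤ K) (hηc : HasCompactSupport η) (hηΩ : tsupport η ⊆ Ω) :
    ∫ x in Ω, G x * (partialDeriv i η x * p x + η x * P i x) = -∫ x in Ω, g x * (η x * p x) := by
  have hdη := continuous_partialDeriv hη i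
  have hdK := abs_partialDeriv_le hK i
  have hsum : ∀ {a b : Rn n → ℝ}, MemL2 Ω a → MemL2 Ω b →
      MemL2 Ω fun x => partialDeriv i η x * a x + η x * b x := fun ha hb =>
    (ha.bdd_mul hdη hdK).add (hb.bdd_mul hη.continuous hη1)
  rw [← sub_eq_zero, sub_neg_eq_add]
  refine eq_zero_of_enorm_le_mul (K := eLpNorm G 2 (volOn Ω) * (ENNReal.ofReal K + 1)
    + eLpNorm g 2 (volOn Ω)) ?_ fun ε hε hε1 => ?_
  · have := hG.2.ne
    have := hg.2.ne
    finiteness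
  obtain ⟨φ, hφ, h1, h2, -⟩ := h.approx ε hε
  have hφ2 : MemL2 Ω φ := memLp_of_eLpNorm_sub_le hφ.continuous h.memL2 hε1 h1
  have hdφ2 : MemL2 Ω (partialDeriv i φ) :=
    memLp_of_eLpNorm_sub_le (continuous_partialDeriv hφ i) (h.grad_memL2 i) hε1 (h2 i)
  have h3 := hGg (fun x => η x * φ x) (hη.mul hφ) hηc.mul_right
    ((tsupport_mul_subset_left).trans hηΩ)
  have hderiv : ∀ x, partialDeriv i (fun x => η x * φ x) x =
      partialDeriv i η x * φ x + η x * partialDeriv i φ x := fun x => by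
    have := ((hη.differentiable (by simp) x).hasFDerivAt.mul
      (hφ.differentiable (by simp) x).hasFDerivAt).fderiv
    unfold partialDeriv
    erw [this]
    simp
    ring
  simp_rw [hderiv] at h3
  have hw1 : MemL2 Ω fun x => φ x - p x := hφ2.sub h.memL2
  have hw2 : MemL2 Ω fun x => partialDeriv i φ x - P i x := hdφ2.sub (h.grad_memL2 i)
  have hw3 := hsum hw1 hw2
  have hw4 := hw1.bdd_mul hη.continuous hη1
  -- The identity holds for `φ`, since `η φ` is an admissible test function. So its defect for `p`
  -- is minus the same expression in `φ - p`, which is small in `L²` for fixed `η`.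
  have h4 : (∫ x in Ω, G x * (partialDeriv i η x * p x + η x * P i x))
      + ∫ x in Ω, g x * (η x * p x) =
      -((∫ x in Ω, G x * (partialDeriv i η x * (φ x - p x) + η x * (partialDeriv i φ x - P i x)))
        + ∫ x in Ω, g x * (η x * (φ x - p x))) := by
    have e1 : ∫ x in Ω, G x * (partialDeriv i η x * (φ x - p x)
        + η x * (partialDeriv i φ x - P i x)) =
        (∫ x in Ω, G x * (partialDeriv i η x * φ x + η x * partialDeriv i φ x))
        - ∫ x in Ω, G x * (partialDeriv i η x * p x + η x * P i x) := by
      rw [← integral_sub (hG.integrable_mul (hsum hφ2 hdφ2))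
        (hG.integrable_mul (hsum h.memL2 (h.grad_memL2 i)))]
      exact integral_congr_ae (Eventually.of_forall fun x => by ring)
    have e2 : ∫ x in Ω, g x * (η x * (φ x - p x)) =
        (∫ x in Ω, g x * (η x * φ x)) - ∫ x in Ω, g x * (η x * p x) := by
      rw [← integral_sub (hg.integrable_mul (hφ2.bdd_mul hη.continuous hη1))
        (hg.integrable_mul (h.memL2.bdd_mul hη.continuous hη1))]
      exact integral_congr_ae (Eventually.of_forall fun x => by ring)
    rw [e1, e2, h3]
    ring
  rw [h4, enorm_neg]
  have hb1 : eLpNorm (fun x => η x * (φ x - p x)) 2 (volOn Ω) ≤ ε := by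
    refine (eLpNorm_bdd_mul_le _ hη1).trans ?_
    simpa using h1
  have hb2 : eLpNorm (fun x => partialDeriv i η x * (φ x - p x)
      + η x * (partialDeriv i φ x - P i x)) 2 (volOn Ω) ≤ ε * (ENNReal.ofReal K + 1) := by
    refine (eLpNorm_add_le (hw1.bdd_mul hdη hdK).1 (hw2.bdd_mul hη.continuous hη1).1
      (by norm_num)).trans ?_
    rw [mul_add, mul_one, mul_comm ε]
    refine add_le_add ((eLpNorm_bdd_mul_le _ hdK).trans (by gcongr)) ?_
    refine (eLpNorm_bdd_mul_le _ hη1).trans ?_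
    simpa using h2 i
  calc _ ≤ _ := enorm_add_le _ _
    _ ≤ eLpNorm G 2 (volOn Ω) * (ε * (ENNReal.ofReal K + 1)) + eLpNorm g 2 (volOn Ω) * ε := by
        refine add_le_add ((enorm_integral_mul_le _ hG.1 hw3.1).trans (by gcongr))
          ((enorm_integral_mul_le _ hg.1 hw4.1).trans (by gcongr))
    _ = _ := by ring

/-- The strips shrink to the empty set because points of the open set `Ω` have positive distance to
its complement; absolute continuity of the integral then applies, boundedness making the measures
finite. -/
lemma tendsto_eLpNorm_strip {Ω : Set (Rn n)} (hΩo : IsOpen Ω) (hne : Ωᶜ.Nonempty)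
    (hΩb : Bornology.IsBounded Ω) {G : Rn n → ℝ} (hG : MemL2 Ω G) :
    Tendsto (fun m : ℕ => eLpNorm G 2 (volume.restrict (strip Ω (1 / ((m : ℝ) + 1))))) atTop
      (𝓝 0) := by
  have hv : Tendsto (fun m : ℕ => volOn Ω (strip Ω (1 / ((m : ℝ) + 1)))) atTop (𝓝 0) := by
    have hanti : Antitone fun m : ℕ => strip Ω (1 / ((m : ℝ) + 1)) := fun a b hab x hx =>
      ⟨hx.1, hx.2.trans_le (one_div_le_one_div_of_le (by positivity) (by gcongr))⟩
    have hemp : ⋂ m : ℕ, strip Ω (1 / ((m : ℝ) + 1)) = ∅ := by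
      rw [eq_empty_iff_forall_notMem]
      intro x hx
      rw [mem_iInter] at hx
      have h0 : Metric.infDist x Ωᶜ ≤ 0 :=
        ge_of_tendsto' tendsto_one_div_add_atTop_nhds_zero_nat fun m => (hx m).2.le
      have h1 := (hΩo.isClosed_compl.mem_iff_infDist_zero hne (x := x)).2
        (le_antisymm h0 Metric.infDist_nonneg)
      exact h1 (hx 0).1
    have h := tendsto_measure_iInter_atTop (μ := volOn Ω)
      (fun m : ℕ => (isOpen_strip hΩo (1 / ((m : ℝ) + 1))).measurableSet.nullMeasurableSet) hanti
      ⟨0, by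
        rw [volOn, Measure.restrict_apply (isOpen_strip hΩo _).measurableSet]
        exact ((measure_mono inter_subset_right).trans_lt hΩb.measure_lt_top).ne⟩
    rwa [hemp, measure_empty] at h
  have h2 : ∫⁻ x, ‖G x‖ₑ ^ 2 ∂(volOn Ω) ≠ ⊤ := by
    rw [← eLpNorm_two_sq]; exact ENNReal.pow_ne_top hG.2.ne
  have h3 := tendsto_setLIntegral_zero h2 hv
  have h4 : ∀ m : ℕ, ∫⁻ x in strip Ω (1 / ((m : ℝ) + 1)), ‖G x‖ₑ ^ 2 ∂(volOn Ω) =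
      eLpNorm G 2 (volume.restrict (strip Ω (1 / ((m : ℝ) + 1)))) ^ 2 := fun m => by
    rw [volOn, Measure.restrict_restrict (isOpen_strip hΩo _).measurableSet,
      inter_eq_self_of_subset_left (strip_subset _ _), eLpNorm_two_sq]
  simp_rw [h4] at h3
  exact tendsto_zero_of_sq_tendsto_zero h3

/-- Integration by parts against a function with vanishing trace. -/
theorem SmoothApprox.integral_mul_grad (hn : 1 ≤ n) {Ω : Set (Rn n)}
    (hΩ : IsBoundedLipschitzDomain Ω) {p : Rn n → ℝ} {P : Fin n → Rn n → ℝ}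
    (h : SmoothApprox Ω p P 0) {i : Fin n} {G g : Rn n → ℝ} (hG : MemL2 Ω G) (hg : MemL2 Ω g)
    (hGg : HasWeakPartial Ω i G g) :
    ∫ x in Ω, G x * P i x = -∫ x in Ω, g x * p x := by
  have hne := compl_nonempty_of_isBounded hn hΩ.isBounded
  obtain ⟨K, ρ, hK, hρ, hstrip⟩ := h.exists_eLpNorm_strip_le hn hΩ
  have hPi := h.grad_memL2 i
  have hp := h.memL2
  set Np := eLpNorm p 2 (volOn Ω)
  set NP := eLpNorm (P i) 2 (volOn Ω)
  -- The error of cutting off lives in the strip. There `|∂ᵢη| ≤ 4 / t` meets `‖p‖ ≤ t * K`, so the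
  -- factors multiplying the strip norms of `G` and `g` do not depend on `t`.
  have hbound : ∀ t, 0 < t → t < ρ →
      ‖(∫ x in Ω, G x * P i x) + ∫ x in Ω, g x * p x‖ₑ ≤
        eLpNorm G 2 (volume.restrict (strip Ω t)) * (NP + 4 * K)
          + eLpNorm g 2 (volume.restrict (strip Ω t)) * Np := by
    intro t ht htρ
    obtain ⟨η, hη, hη0, hη1, hηK, hηc, hηΩ, hηs⟩ := exists_cutoff hΩ.isBounded ht
    have hηabs : ∀ x, |η x| ≤ 1 := fun x => by rw [abs_of_nonneg (hη0 x)]; exact hη1 x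
    have hdK := abs_partialDeriv_le hηK i
    have h1 := h.integral_cutoff hG hg hGg hη hηabs hηK hηc hηΩ
    have hle : volume.restrict (strip Ω t) ≤ volOn Ω :=
      Measure.restrict_mono (strip_subset Ω t) le_rfl
    have hGs := hG.1.mono_measure hle
    have hgs := hg.1.mono_measure hle
    have hps := hp.1.mono_measure hle
    have hPs := hPi.1.mono_measure hle
    set R : Rn n → ℝ := fun x => G x * ((1 - η x) * P i x - partialDeriv i η x * p x)
      + g x * ((1 - η x) * p x) with hR
    have hsum : MemL2 Ω fun x => partialDeriv i η x * p x + η x * P i x :=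
      (hp.bdd_mul (continuous_partialDeriv hη i) hdK).add (hPi.bdd_mul hη.continuous hηabs)
    have hηp := hp.bdd_mul hη.continuous hηabs
    have h2 : (∫ x in Ω, G x * P i x) + ∫ x in Ω, g x * p x = ∫ x in Ω, R x := by
      have e1 : ∫ x in Ω, R x =
          ∫ x in Ω, ((G x * P i x + g x * p x) -
            (G x * (partialDeriv i η x * p x + η x * P i x) + g x * (η x * p x))) :=
        integral_congr_ae (Eventually.of_forall fun x => by simp only [hR]; ring)
      have i1 : Integrable (fun x => G x * P i x + g x * p x) (volume.restrict Ω) :=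
        (hG.integrable_mul hPi).add (hg.integrable_mul hp)
      have i2 : Integrable (fun x => G x * (partialDeriv i η x * p x + η x * P i x)
          + g x * (η x * p x)) (volume.restrict Ω) :=
        (hG.integrable_mul hsum).add (hg.integrable_mul hηp)
      rw [e1, integral_sub i1 i2,
        integral_add (hG.integrable_mul hPi) (hg.integrable_mul hp),
        integral_add (hG.integrable_mul hsum) (hg.integrable_mul hηp), h1]
      ring
    have hR0 : ∀ x ∈ Ω \ strip Ω t, R x = 0 := fun x hx => by
      have e1 := hηs x hx
      -- `Ω \ strip Ω t` need not be open, so `η = 1` there cannot simply be differentiated; but `1`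
      -- is the maximum of `η`.
      have e2 : fderiv ℝ η x = 0 :=
        IsLocalMax.fderiv_eq_zero (Eventually.of_forall fun y => by rw [e1]; exact hη1 y)
      simp [hR, e1, partialDeriv, e2]
    have h3 : ∫ x in Ω, R x = ∫ x in strip Ω t, R x :=
      setIntegral_eq_of_subset_of_forall_sdiff_eq_zero hΩ.isOpen.measurableSet
        (strip_subset Ω t) hR0
    rw [h2, h3]
    have hη1' : ∀ x, |1 - η x| ≤ 1 := fun x =>
      abs_le.2 ⟨by linarith [hη1 x], by linarith [hη0 x]⟩
    have hmη : AEStronglyMeasurable (fun x => 1 - η x) (volume.restrict (strip Ω t)) :=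
      (continuous_const.sub hη.continuous).aestronglyMeasurable
    have hmd : AEStronglyMeasurable (partialDeriv i η) (volume.restrict (strip Ω t)) :=
      (continuous_partialDeriv hη i).aestronglyMeasurable
    have hm1 : AEStronglyMeasurable (fun x => (1 - η x) * P i x - partialDeriv i η x * p x)
        (volume.restrict (strip Ω t)) := (hmη.mul hPs).sub (hmd.mul hps)
    have hm2 : AEStronglyMeasurable (fun x => (1 - η x) * p x) (volume.restrict (strip Ω t)) :=
      hmη.mul hps
    have hb1 : eLpNorm (fun x => (1 - η x) * P i x - partialDeriv i η x * p x) 2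
        (volume.restrict (strip Ω t)) ≤ NP + 4 * K := by
      refine (eLpNorm_sub_le (hmη.mul hPs) (hmd.mul hps) (by norm_num)).trans (add_le_add ?_ ?_)
      · refine (eLpNorm_bdd_mul_le _ hη1').trans ?_
        simpa using eLpNorm_mono_measure _ hle
      · refine (eLpNorm_bdd_mul_le _ hdK).trans ?_
        calc _ ≤ ENNReal.ofReal (4 / t) * (ENNReal.ofReal t * K) := by
              gcongr; exact hstrip t ht htρ
          _ = 4 * K := by
              rw [← mul_assoc, ← ENNReal.ofReal_mul (by positivity), div_mul_cancel₀ _ ht.ne']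
              simp
    have hb2 : eLpNorm (fun x => (1 - η x) * p x) 2 (volume.restrict (strip Ω t)) ≤ Np := by
      refine (eLpNorm_bdd_mul_le _ hη1').trans ?_
      simpa using eLpNorm_mono_measure _ hle
    calc ‖∫ x in strip Ω t, R x‖ₑ ≤ ∫⁻ x in strip Ω t, ‖R x‖ₑ :=
          enorm_integral_le_lintegral_enorm _
      _ ≤ ∫⁻ x in strip Ω t, (‖G x‖ₑ * ‖(1 - η x) * P i x - partialDeriv i η x * p x‖ₑ
            + ‖g x‖ₑ * ‖(1 - η x) * p x‖ₑ) := by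
          refine lintegral_mono fun x => ?_
          rw [← enorm_mul, ← enorm_mul]
          exact enorm_add_le _ _
      _ = (∫⁻ x in strip Ω t, ‖G x‖ₑ * ‖(1 - η x) * P i x - partialDeriv i η x * p x‖ₑ)
            + ∫⁻ x in strip Ω t, ‖g x‖ₑ * ‖(1 - η x) * p x‖ₑ :=
          lintegral_add_left' (hGs.enorm.mul hm1.enorm) _
      _ ≤ _ := add_le_add
          ((lintegral_enorm_mul_enorm_le _ hGs hm1).trans (by gcongr))
          ((lintegral_enorm_mul_enorm_le _ hgs hm2).trans (by gcongr))
  have hNP : NP + 4 * K ≠ ⊤ := by have : NP ≠ ⊤ := hPi.2.ne; finiteness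
  have hNp : Np ≠ ⊤ := hp.2.ne
  have hlim := (ENNReal.Tendsto.mul_const
      (tendsto_eLpNorm_strip hΩ.isOpen hne hΩ.isBounded hG) (Or.inr hNP)).add
    (ENNReal.Tendsto.mul_const
      (tendsto_eLpNorm_strip hΩ.isOpen hne hΩ.isBounded hg) (Or.inr hNp))
  have hle := ge_of_tendsto hlim (b := ‖(∫ x in Ω, G x * P i x) + ∫ x in Ω, g x * p x‖ₑ) (by
    filter_upwards [tendsto_one_div_add_atTop_nhds_zero_nat.eventually (gt_mem_nhds hρ)] with m hm
    exact hbound _ (by positivity) hm)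
  rw [zero_mul, zero_mul, add_zero, nonpos_iff_eq_zero, enorm_eq_zero] at hle
  exact eq_neg_of_add_eq_zero_left hle

/-! ### Smooth approximations of the positive part. -/

section PositivePart

/-- A smooth nonnegative approximation of the positive part, vanishing on `(-∞, 0]`. -/
noncomputable def smoothPosPart (t : ℝ) : ℝ := ∫ r in (0 : ℝ)..t, Real.smoothTransition r

lemma hasDerivAt_smoothPosPart (t : ℝ) :
    HasDerivAt smoothPosPart (Real.smoothTransition t) t :=
  intervalIntegral.integral_hasDerivAt_right
    (Real.smoothTransition.continuous.intervalIntegrable _ _)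
    (Real.smoothTransition.continuous.stronglyMeasurableAtFilter _ _)
    Real.smoothTransition.continuous.continuousAt

lemma contDiff_smoothPosPart : ContDiff ℝ ∞ smoothPosPart := by
  rw [contDiff_infty_iff_deriv]
  refine ⟨fun t => (hasDerivAt_smoothPosPart t).differentiableAt, ?_⟩
  rw [show deriv smoothPosPart = Real.smoothTransition from
    funext fun t => (hasDerivAt_smoothPosPart t).deriv]
  exact Real.smoothTransition.contDiff

lemma smoothPosPart_of_nonpos {t : ℝ} (ht : t ≤ 0) : smoothPosPart t = 0 := by
  rw [smoothPosPart, intervalIntegral.integral_symm, neg_eq_zero]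
  refine intervalIntegral.integral_zero_ae (Eventually.of_forall fun r hr => ?_)
  rw [uIoc_of_le ht] at hr
  exact Real.smoothTransition.zero_of_nonpos hr.2

lemma smoothPosPart_le {t : ℝ} (ht : 0 ≤ t) : smoothPosPart t ≤ t := by
  have h := intervalIntegral.integral_mono_on ht
    (Real.smoothTransition.continuous.intervalIntegrable 0 t)
    (continuous_const.intervalIntegrable 0 t) (μ := volume) (g := fun _ => (1 : ℝ))
    fun r _ => Real.smoothTransition.le_one r
  simpa [smoothPosPart] using h

lemma smoothPosPart_nonneg {t : ℝ} (ht : 0 ≤ t) : 0 ≤ smoothPosPart t :=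
  intervalIntegral.integral_nonneg ht fun r _ => Real.smoothTransition.nonneg r

lemma sub_one_le_smoothPosPart (t : ℝ) (ht : 0 ≤ t) : t - 1 ≤ smoothPosPart t := by
  rcases le_total t 1 with h | h
  · exact (sub_nonpos.2 h).trans (smoothPosPart_nonneg ht)
  · have h1 : smoothPosPart t = smoothPosPart 1 + ∫ r in (1 : ℝ)..t, Real.smoothTransition r :=
      (intervalIntegral.integral_add_adjacent_intervals
        (Real.smoothTransition.continuous.intervalIntegrable _ _)
        (Real.smoothTransition.continuous.intervalIntegrable _ _)).symm
    have h2 : ∫ r in (1 : ℝ)..t, Real.smoothTransition r = t - 1 := by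
      rw [intervalIntegral.integral_congr (g := fun _ => (1 : ℝ)) fun r hr => ?_]
      · simp
      · rw [uIcc_of_le h] at hr
        exact Real.smoothTransition.one_of_one_le hr.1
    rw [h1, h2]
    linarith [smoothPosPart_nonneg zero_le_one]

/-- The bound is uniform in `t`, so rescaling by `N + 1` leaves an error of at most `1 / (N + 1)`.
-/
lemma abs_smoothPosPart_sub_le (t : ℝ) : |smoothPosPart t - max t 0| ≤ 1 := by
  rcases le_total t 0 with h | h
  · simp [smoothPosPart_of_nonpos h, max_eq_right h]
  · rw [max_eq_left h, abs_le]
    constructor <;> linarith [sub_one_le_smoothPosPart t h, smoothPosPart_le h]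

/-- The rescaled functions `t ↦ smoothPosPart (N t) / N`, which converge to the positive part. -/
noncomputable def scaledPosPart (N : ℕ) (t : ℝ) : ℝ :=
  smoothPosPart (((N : ℝ) + 1) * t) / ((N : ℝ) + 1)

lemma contDiff_scaledPosPart (N : ℕ) : ContDiff ℝ ∞ (scaledPosPart N) :=
  (contDiff_smoothPosPart.comp (contDiff_const.mul contDiff_id)).div_const _

lemma hasDerivAt_scaledPosPart (N : ℕ) (t : ℝ) :
    HasDerivAt (scaledPosPart N) (Real.smoothTransition (((N : ℝ) + 1) * t)) t := by
  have h1 : HasDerivAt (fun t : ℝ => ((N : ℝ) + 1) * t) ((N : ℝ) + 1) t := by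
    simpa using (hasDerivAt_id t).const_mul ((N : ℝ) + 1)
  have h2 := ((hasDerivAt_smoothPosPart (((N : ℝ) + 1) * t)).comp t h1).div_const ((N : ℝ) + 1)
  have h3 : (N : ℝ) + 1 ≠ 0 := by positivity
  rwa [mul_div_cancel_right₀ _ h3] at h2

lemma deriv_scaledPosPart (N : ℕ) (t : ℝ) :
    deriv (scaledPosPart N) t = Real.smoothTransition (((N : ℝ) + 1) * t) :=
  (hasDerivAt_scaledPosPart N t).deriv

lemma abs_deriv_scaledPosPart_le (N : ℕ) (t : ℝ) : |deriv (scaledPosPart N) t| ≤ 1 := by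
  rw [deriv_scaledPosPart, abs_of_nonneg (Real.smoothTransition.nonneg _)]
  exact Real.smoothTransition.le_one _

lemma scaledPosPart_of_nonpos (N : ℕ) {t : ℝ} (ht : t ≤ 0) : scaledPosPart N t = 0 := by
  rw [scaledPosPart, smoothPosPart_of_nonpos (mul_nonpos_of_nonneg_of_nonpos (by positivity) ht),
    zero_div]

lemma tendsto_scaledPosPart (t : ℝ) :
    Tendsto (fun N => scaledPosPart N t) atTop (𝓝 (max t 0)) := by
  rw [tendsto_iff_dist_tendsto_zero]
  refine squeeze_zero (fun N => dist_nonneg) (fun N => ?_)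
    (tendsto_one_div_add_atTop_nhds_zero_nat (𝕜 := ℝ))
  have h0 : (0 : ℝ) < (N : ℝ) + 1 := by positivity
  have h := abs_smoothPosPart_sub_le (((N : ℝ) + 1) * t)
  have h1 : max (((N : ℝ) + 1) * t) 0 = ((N : ℝ) + 1) * max t 0 := by
    rw [mul_max_of_nonneg _ _ h0.le, mul_zero]
  rw [h1] at h
  have h2 : scaledPosPart N t - max t 0 =
      (smoothPosPart (((N : ℝ) + 1) * t) - ((N : ℝ) + 1) * max t 0) / ((N : ℝ) + 1) := by
    rw [scaledPosPart]; field_simp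
  rw [Real.dist_eq, h2, abs_div, abs_of_pos h0]
  gcongr

/-- At `t = 0` every derivative is already `0`, so convergence holds everywhere and no information
on the level set `{u = 0}` is needed. -/
lemma tendsto_deriv_scaledPosPart (t : ℝ) :
    Tendsto (fun N => deriv (scaledPosPart N) t) atTop (𝓝 (if 0 < t then 1 else 0)) := by
  simp_rw [deriv_scaledPosPart]
  split_ifs with h
  · refine tendsto_const_nhds.congr' ?_
    obtain ⟨M, hM⟩ := exists_nat_gt (1 / t)
    filter_upwards [eventually_ge_atTop M] with N hN
    refine (Real.smoothTransition.one_of_one_le ?_).symm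
    have h1 : (M : ℝ) ≤ N := by exact_mod_cast hN
    rw [div_lt_iff₀ h] at hM
    nlinarith
  · refine tendsto_const_nhds.congr fun N => (Real.smoothTransition.zero_of_nonpos ?_).symm
    exact mul_nonpos_of_nonneg_of_nonpos (by positivity) (not_lt.1 h)

end PositivePart

/-! ### Chain rule and positive part for `SmoothApprox`. -/

variable {Ω : Set (Rn n)} {u g : Rn n → ℝ} {G : Fin n → Rn n → ℝ}

lemma SmoothApprox.of_seq (hu : MemL2 Ω u) (hG : ∀ i, MemL2 Ω (G i))
    (hg : MemLp g 2 (surfaceMeasure Ω)) {φ : ℕ → Rn n → ℝ} (hφ : ∀ m, ContDiff ℝ ∞ (φ m))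
    (h1 : Tendsto (fun m => eLpNorm (fun x => φ m x - u x) 2 (volOn Ω)) atTop (𝓝 0))
    (h2 : ∀ i, Tendsto (fun m => eLpNorm (fun x => partialDeriv i (φ m) x - G i x) 2 (volOn Ω))
      atTop (𝓝 0))
    (h3 : Tendsto (fun m => eLpNorm (fun x => φ m x - g x) 2 (surfaceMeasure Ω)) atTop (𝓝 0)) :
    SmoothApprox Ω u G g := by
  refine ⟨hu, hG, hg, fun ε hε => ?_⟩
  obtain ⟨m, hm1, hm2, hm3⟩ := ((h1.eventually_le_const hε).and
    ((eventually_all.2 fun i => (h2 i).eventually_le_const hε).and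
      (h3.eventually_le_const hε))).exists
  exact ⟨φ m, hφ m, hm1, hm2, hm3⟩

lemma SmoothApprox.exists_seq (h : SmoothApprox Ω u G g) :
    ∃ φ : ℕ → Rn n → ℝ, (∀ m, ContDiff ℝ ∞ (φ m)) ∧
      Tendsto (fun m => eLpNorm (fun x => φ m x - u x) 2 (volOn Ω)) atTop (𝓝 0) ∧
      (∀ i, Tendsto (fun m => eLpNorm (fun x => partialDeriv i (φ m) x - G i x) 2 (volOn Ω))
        atTop (𝓝 0)) ∧
      Tendsto (fun m => eLpNorm (fun x => φ m x - g x) 2 (surfaceMeasure Ω)) atTop (𝓝 0) := by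
  have hε : Tendsto (fun m : ℕ => (m : ℝ≥0∞)⁻¹) atTop (𝓝 0) :=
    ENNReal.tendsto_inv_nat_nhds_zero
  choose φ h1 h2 h3 h4 using fun m : ℕ =>
    h.approx (m : ℝ≥0∞)⁻¹ (ENNReal.inv_pos.2 (ENNReal.natCast_ne_top m))
  exact ⟨φ, h1, tendsto_of_tendsto_of_tendsto_of_le_of_le tendsto_const_nhds hε
    (fun _ => zero_le) h2, fun i => tendsto_of_tendsto_of_tendsto_of_le_of_le tendsto_const_nhds hε
    (fun _ => zero_le) fun m => h3 m i, tendsto_of_tendsto_of_tendsto_of_le_of_le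
    tendsto_const_nhds hε (fun _ => zero_le) h4⟩

/-- As `SmoothApprox.exists_seq`, with almost everywhere convergence in addition. -/
lemma SmoothApprox.exists_seq_ae (h : SmoothApprox Ω u G g) :
    ∃ φ : ℕ → Rn n → ℝ, (∀ m, ContDiff ℝ ∞ (φ m)) ∧
      Tendsto (fun m => eLpNorm (fun x => φ m x - u x) 2 (volOn Ω)) atTop (𝓝 0) ∧
      (∀ i, Tendsto (fun m => eLpNorm (fun x => partialDeriv i (φ m) x - G i x) 2 (volOn Ω))
        atTop (𝓝 0)) ∧
      Tendsto (fun m => eLpNorm (fun x => φ m x - g x) 2 (surfaceMeasure Ω)) atTop (𝓝 0) ∧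
      ∀ᵐ x ∂(volOn Ω), Tendsto (fun m => φ m x) atTop (𝓝 (u x)) := by
  obtain ⟨φ, h0, h1, h2, h3⟩ := h.exists_seq
  obtain ⟨ns, hns, hae⟩ := (tendstoInMeasure_of_tendsto_eLpNorm (p := 2) two_ne_zero
    (fun m => (h0 m).continuous.aestronglyMeasurable) h.memL2.1 h1).exists_seq_tendsto_ae
  have ht := hns.tendsto_atTop
  exact ⟨fun m => φ (ns m), fun m => h0 _, h1.comp ht, fun i => (h2 i).comp ht, h3.comp ht, hae⟩

lemma partialDeriv_comp {F : ℝ → ℝ} (hF : ContDiff ℝ ∞ F) {φ : Rn n → ℝ} (hφ : ContDiff ℝ ∞ φ)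
    (i : Fin n) (x : Rn n) :
    partialDeriv i (fun x => F (φ x)) x = deriv F (φ x) * partialDeriv i φ x := by
  have h := ((hF.differentiable (by simp) (φ x)).hasDerivAt.comp_hasFDerivAt x
    (hφ.differentiable (by simp) x).hasFDerivAt).fderiv
  unfold partialDeriv
  erw [h]
  simp

lemma abs_sub_le_abs_two {a b : ℝ} (ha : |a| ≤ 1) (hb : |b| ≤ 1) : |a - b| ≤ |(2 : ℝ)| := by
  rw [abs_le] at *
  rw [abs_two]
  constructor <;> linarith

/-- Chain rule. -/
lemma SmoothApprox.comp (h : SmoothApprox Ω u G g) (hg : ∀ᵐ x ∂(surfaceMeasure Ω), g x ≤ 0)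
    {F : ℝ → ℝ} (hF : ContDiff ℝ ∞ F) (hF1 : ∀ t, |deriv F t| ≤ 1) (hF0 : ∀ t ≤ 0, F t = 0) :
    SmoothApprox Ω (fun x => F (u x)) (fun i x => deriv F (u x) * G i x) 0 := by
  obtain ⟨φ, h0, h1, h2, h3, hae⟩ := h.exists_seq_ae
  have hdF : Continuous (deriv F) := hF.continuous_deriv (by simp)
  have hlip : ∀ s t, |F s - F t| ≤ |s - t| := fun s t => by
    have := Convex.norm_image_sub_le_of_norm_deriv_le (f := F) (C := 1) (s := univ) (x := t) (y := s)
      (fun x _ => hF.differentiable (by simp) x) (fun x _ => hF1 x) convex_univ (mem_univ _)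
      (mem_univ _)
    simpa using this
  have hmd : ∀ i, AEStronglyMeasurable (fun x => deriv F (u x) * G i x) (volOn Ω) := fun i =>
    (hdF.comp_aestronglyMeasurable h.memL2.1).mul (h.grad_memL2 i).1
  refine SmoothApprox.of_seq (φ := fun m x => F (φ m x)) ?_ (fun i => ?_) MemLp.zero
    (fun m => hF.comp (h0 m)) ?_ (fun i => ?_) ?_
  · refine h.memL2.of_le (hF.continuous.comp_aestronglyMeasurable h.memL2.1)
      (Eventually.of_forall fun x => ?_)
    have := hlip (u x) 0
    rwa [hF0 0 le_rfl, sub_zero, sub_zero] at this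
  · refine (h.grad_memL2 i).of_le (hmd i) (Eventually.of_forall fun x => ?_)
    rw [norm_mul]
    exact mul_le_of_le_one_left (norm_nonneg _) (hF1 _)
  · exact tendsto_of_tendsto_of_tendsto_of_le_of_le tendsto_const_nhds h1 (fun _ => zero_le)
      fun m => eLpNorm_mono fun x => hlip _ _
  · have hmφ : ∀ m, AEStronglyMeasurable (fun x => deriv F (φ m x)) (volOn Ω) := fun m =>
      (hdF.comp (h0 m).continuous).aestronglyMeasurable
    -- The gradient error splits as `F'(φₘ)(∂ᵢφₘ - Gᵢ) + (F'(φₘ) - F'(u))Gᵢ`. The second term needs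
    -- dominated convergence, hence the almost everywhere convergent sequence.
    have h4 : Tendsto (fun m => eLpNorm (fun x => deriv F (φ m x) * G i x - deriv F (u x) * G i x) 2
        (volOn Ω)) atTop (𝓝 0) := by
      refine tendsto_eLpNorm_sub_of_dominated (h := fun x => 2 * G i x)
        (fun m => (hmφ m).mul (h.grad_memL2 i).1) (hmd i) ((h.grad_memL2 i).const_mul 2)
        (fun m => Eventually.of_forall fun x => ?_) ?_
      · rw [← sub_mul, abs_mul, abs_mul]
        refine mul_le_mul_of_nonneg_right ?_ (abs_nonneg _)
        exact abs_sub_le_abs_two (hF1 _) (hF1 _)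
      · filter_upwards [hae] with x hx
        exact ((hdF.tendsto _).comp hx).mul_const _
    have h5 := (h2 i).add h4
    rw [add_zero] at h5
    refine tendsto_of_tendsto_of_tendsto_of_le_of_le tendsto_const_nhds h5 (fun _ => zero_le)
      fun m => ?_
    have hm1 : AEStronglyMeasurable (fun x => deriv F (φ m x) * (partialDeriv i (φ m) x - G i x))
        (volOn Ω) := (hmφ m).mul
          ((continuous_partialDeriv (h0 m) i).aestronglyMeasurable.sub (h.grad_memL2 i).1)
    have e : (fun x => partialDeriv i (fun x => F (φ m x)) x - deriv F (u x) * G i x) =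
        (fun x => deriv F (φ m x) * (partialDeriv i (φ m) x - G i x)) +
          fun x => deriv F (φ m x) * G i x - deriv F (u x) * G i x := by
      ext x
      rw [Pi.add_apply, partialDeriv_comp hF (h0 m)]
      ring
    rw [e]
    refine (eLpNorm_add_le hm1 (((hmφ m).mul (h.grad_memL2 i).1).sub (hmd i))
      (by norm_num)).trans (add_le_add ?_ le_rfl)
    refine (eLpNorm_bdd_mul_le _ fun x => hF1 (φ m x)).trans ?_
    simp
  -- The sign of the trace enters here: `F(g) = 0`, so `|F(φₘ)| ≤ |φₘ - g|` on the boundary.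
  · refine tendsto_of_tendsto_of_tendsto_of_le_of_le tendsto_const_nhds h3 (fun _ => zero_le)
      fun m => eLpNorm_mono_ae ?_
    filter_upwards [hg] with x hx
    have := hlip (φ m x) (g x)
    rw [hF0 _ hx] at this
    simpa using this

/-- Closedness under `H¹` limits with fixed trace. -/
lemma SmoothApprox.of_tendsto (hu : MemL2 Ω u) (hG : ∀ i, MemL2 Ω (G i))
    {v : ℕ → Rn n → ℝ} {V : ℕ → Fin n → Rn n → ℝ} (h : ∀ m, SmoothApprox Ω (v m) (V m) g)
    (h1 : Tendsto (fun m => eLpNorm (fun x => v m x - u x) 2 (volOn Ω)) atTop (𝓝 0))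
    (h2 : ∀ i, Tendsto (fun m => eLpNorm (fun x => V m i x - G i x) 2 (volOn Ω)) atTop (𝓝 0)) :
    SmoothApprox Ω u G g := by
  have htri : ∀ {a b c : Rn n → ℝ} {ε : ℝ≥0∞}, AEStronglyMeasurable a (volOn Ω) →
      AEStronglyMeasurable b (volOn Ω) → AEStronglyMeasurable c (volOn Ω) →
      eLpNorm (fun x => a x - b x) 2 (volOn Ω) ≤ ε / 2 →
      eLpNorm (fun x => b x - c x) 2 (volOn Ω) ≤ ε / 2 →
      eLpNorm (fun x => a x - c x) 2 (volOn Ω) ≤ ε := fun {a b c ε} ha hb hc hab hbc => by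
    have e : (fun x => a x - c x) = (fun x => a x - b x) + fun x => b x - c x := by
      ext x; simp
    rw [e]
    refine (eLpNorm_add_le (ha.sub hb) (hb.sub hc) (by norm_num)).trans ?_
    exact (add_le_add hab hbc).trans (ENNReal.add_halves ε).le
  refine ⟨hu, hG, (h 0).memLp_trace, fun ε hε => ?_⟩
  have hε2 := ENNReal.half_pos hε.ne'
  obtain ⟨m, hm1, hm2⟩ := ((h1.eventually_le_const hε2).and
    (eventually_all.2 fun i => (h2 i).eventually_le_const hε2)).exists
  obtain ⟨φ, hφ, e1, e2, e3⟩ := (h m).approx (ε / 2) hε2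
  exact ⟨φ, hφ, htri hφ.continuous.aestronglyMeasurable (h m).memL2.1 hu.1 e1 hm1,
    fun i => htri (continuous_partialDeriv hφ i).aestronglyMeasurable ((h m).grad_memL2 i).1
      (hG i).1 (e2 i) (hm2 i), e3.trans ENNReal.half_le_self⟩

/-- The positive part of an `H¹` function with nonpositive trace has zero trace. -/
theorem SmoothApprox.posPart (h : SmoothApprox Ω u G g)
    (hg : ∀ᵐ x ∂(surfaceMeasure Ω), g x ≤ 0) :
    SmoothApprox Ω (fun x => max (u x) 0) (fun i x => (if 0 < u x then 1 else 0) * G i x) 0 := by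
  have hN : ∀ N : ℕ, SmoothApprox Ω (fun x => scaledPosPart N (u x))
      (fun i x => deriv (scaledPosPart N) (u x) * G i x) 0 := fun N =>
    h.comp hg (contDiff_scaledPosPart N) (abs_deriv_scaledPosPart_le N)
      fun t ht => scaledPosPart_of_nonpos N ht
  have hpos : MemL2 Ω fun x => max (u x) 0 := MemLp.pos_part h.memL2
  have hlim : ∀ i x, Tendsto (fun N => deriv (scaledPosPart N) (u x) * G i x) atTop
      (𝓝 ((if 0 < u x then 1 else 0) * G i x)) := fun i x =>
    (tendsto_deriv_scaledPosPart (u x)).mul_const _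
  have hle : ∀ t : ℝ, |if 0 < t then (1 : ℝ) else 0| ≤ 1 := fun t => by split_ifs <;> simp
  have hGm : ∀ i, AEStronglyMeasurable (fun x => (if 0 < u x then 1 else 0) * G i x) (volOn Ω) :=
    fun i => aestronglyMeasurable_of_tendsto_ae atTop (fun N => ((hN N).grad_memL2 i).1)
      (Eventually.of_forall (hlim i))
  refine SmoothApprox.of_tendsto hpos (fun i => ?_) hN ?_ fun i => ?_
  · refine (h.grad_memL2 i).of_le (hGm i) (Eventually.of_forall fun x => ?_)
    rw [norm_mul]
    exact mul_le_of_le_one_left (norm_nonneg _) (hle _)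
  · refine tendsto_eLpNorm_sub_of_dominated (fun N => (hN N).memL2.1) hpos.1 h.memL2
      (fun N => Eventually.of_forall fun x => ?_)
      (Eventually.of_forall fun x => tendsto_scaledPosPart (u x))
    rcases le_total (u x) 0 with hx | hx
    · simp [scaledPosPart_of_nonpos N hx, max_eq_right hx]
    · have h0 : (0 : ℝ) < (N : ℝ) + 1 := by positivity
      have h1 : 0 ≤ ((N : ℝ) + 1) * u x := by positivity
      have h2 : 0 ≤ scaledPosPart N (u x) := div_nonneg (smoothPosPart_nonneg h1) h0.le
      have h3 : scaledPosPart N (u x) ≤ u x := by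
        rw [scaledPosPart, div_le_iff₀ h0, mul_comm (u x)]
        exact smoothPosPart_le h1
      rw [max_eq_left hx, abs_of_nonneg hx, abs_le]
      constructor <;> linarith
  · refine tendsto_eLpNorm_sub_of_dominated (h := fun x => 2 * G i x)
      (fun N => ((hN N).grad_memL2 i).1) (hGm i) ((h.grad_memL2 i).const_mul 2)
      (fun N => Eventually.of_forall fun x => ?_) (Eventually.of_forall (hlim i))
    rw [← sub_mul, abs_mul, abs_mul]
    refine mul_le_mul_of_nonneg_right ?_ (abs_nonneg _)
    exact abs_sub_le_abs_two (abs_deriv_scaledPosPart_le N (u x)) (hle (u x))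

/-! ### Sums and differences; return to `weakPartial` and `HasTrace`. -/

variable {v c : Rn n → ℝ} {V : Fin n → Rn n → ℝ}

lemma partialDeriv_add {φ χ : Rn n → ℝ} (hφ : ContDiff ℝ ∞ φ) (hχ : ContDiff ℝ ∞ χ) (i : Fin n)
    (x : Rn n) : partialDeriv i (fun x => φ x + χ x) x = partialDeriv i φ x + partialDeriv i χ x := by
  simp [partialDeriv, fderiv_fun_add (hφ.differentiable (by simp) x)
    (hχ.differentiable (by simp) x)]

lemma partialDeriv_sub {φ χ : Rn n → ℝ} (hφ : ContDiff ℝ ∞ φ) (hχ : ContDiff ℝ ∞ χ) (i : Fin n)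
    (x : Rn n) : partialDeriv i (fun x => φ x - χ x) x = partialDeriv i φ x - partialDeriv i χ x := by
  simp [partialDeriv, fderiv_fun_sub (hφ.differentiable (by simp) x)
    (hχ.differentiable (by simp) x)]

lemma eLpNorm_add_sub_add_le {μ : Measure (Rn n)} {a a' b b' : Rn n → ℝ}
    (ha : AEStronglyMeasurable (fun x => a x - a' x) μ)
    (hb : AEStronglyMeasurable (fun x => b x - b' x) μ) {ε : ℝ≥0∞}
    (h : eLpNorm (fun x => a x - a' x) 2 μ ≤ ε / 2)
    (h' : eLpNorm (fun x => b x - b' x) 2 μ ≤ ε / 2) :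
    eLpNorm (fun x => a x + b x - (a' x + b' x)) 2 μ ≤ ε ∧
      eLpNorm (fun x => a x - b x - (a' x - b' x)) 2 μ ≤ ε := by
  have e1 : (fun x => a x + b x - (a' x + b' x)) =
      (fun x => a x - a' x) + fun x => b x - b' x := by
    ext x; simp; ring
  have e2 : (fun x => a x - b x - (a' x - b' x)) =
      (fun x => a x - a' x) - fun x => b x - b' x := by
    ext x; simp; ring
  rw [e1, e2]
  exact ⟨(eLpNorm_add_le ha hb (by norm_num)).trans
      ((add_le_add h h').trans (ENNReal.add_halves ε).le),
    (eLpNorm_sub_le ha hb (by norm_num)).trans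
      ((add_le_add h h').trans (ENNReal.add_halves ε).le)⟩

lemma SmoothApprox.add (h : SmoothApprox Ω u G g) (h' : SmoothApprox Ω v V c) :
    SmoothApprox Ω (fun x => u x + v x) (fun i x => G i x + V i x) (fun x => g x + c x) := by
  refine ⟨h.memL2.add h'.memL2, fun i => (h.grad_memL2 i).add (h'.grad_memL2 i),
    h.memLp_trace.add h'.memLp_trace, fun ε hε => ?_⟩
  obtain ⟨φ, hφ, h1, h2, h3⟩ := h.approx (ε / 2) (ENNReal.half_pos hε.ne')
  obtain ⟨χ, hχ, k1, k2, k3⟩ := h'.approx (ε / 2) (ENNReal.half_pos hε.ne')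
  refine ⟨fun x => φ x + χ x, hφ.add hχ, ?_, fun i => ?_, ?_⟩
  · exact (eLpNorm_add_sub_add_le (hφ.continuous.aestronglyMeasurable.sub h.memL2.1)
      (hχ.continuous.aestronglyMeasurable.sub h'.memL2.1) h1 k1).1
  · simp_rw [partialDeriv_add hφ hχ]
    exact (eLpNorm_add_sub_add_le
      ((continuous_partialDeriv hφ i).aestronglyMeasurable.sub (h.grad_memL2 i).1)
      ((continuous_partialDeriv hχ i).aestronglyMeasurable.sub (h'.grad_memL2 i).1)
      (h2 i) (k2 i)).1
  · exact (eLpNorm_add_sub_add_le (hφ.continuous.aestronglyMeasurable.sub h.memLp_trace.1)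
      (hχ.continuous.aestronglyMeasurable.sub h'.memLp_trace.1) h3 k3).1

lemma SmoothApprox.sub (h : SmoothApprox Ω u G g) (h' : SmoothApprox Ω v V c) :
    SmoothApprox Ω (fun x => u x - v x) (fun i x => G i x - V i x) (fun x => g x - c x) := by
  refine ⟨h.memL2.sub h'.memL2, fun i => (h.grad_memL2 i).sub (h'.grad_memL2 i),
    h.memLp_trace.sub h'.memLp_trace, fun ε hε => ?_⟩
  obtain ⟨φ, hφ, h1, h2, h3⟩ := h.approx (ε / 2) (ENNReal.half_pos hε.ne')
  obtain ⟨χ, hχ, k1, k2, k3⟩ := h'.approx (ε / 2) (ENNReal.half_pos hε.ne')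
  refine ⟨fun x => φ x - χ x, hφ.sub hχ, ?_, fun i => ?_, ?_⟩
  · exact (eLpNorm_add_sub_add_le (hφ.continuous.aestronglyMeasurable.sub h.memL2.1)
      (hχ.continuous.aestronglyMeasurable.sub h'.memL2.1) h1 k1).2
  · simp_rw [partialDeriv_sub hφ hχ]
    exact (eLpNorm_add_sub_add_le
      ((continuous_partialDeriv hφ i).aestronglyMeasurable.sub (h.grad_memL2 i).1)
      ((continuous_partialDeriv hχ i).aestronglyMeasurable.sub (h'.grad_memL2 i).1)
      (h2 i) (k2 i)).2
  · exact (eLpNorm_add_sub_add_le (hφ.continuous.aestronglyMeasurable.sub h.memLp_trace.1)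
      (hχ.continuous.aestronglyMeasurable.sub h'.memLp_trace.1) h3 k3).2

lemma SmoothApprox.congr_trace (h : SmoothApprox Ω u G g)
    (hgc : g =ᵐ[surfaceMeasure Ω] c) : SmoothApprox Ω u G c := by
  refine ⟨h.memL2, h.grad_memL2, h.memLp_trace.ae_eq hgc, fun ε hε => ?_⟩
  obtain ⟨φ, hφ, h1, h2, h3⟩ := h.approx ε hε
  refine ⟨φ, hφ, h1, h2, (eLpNorm_congr_ae ?_).le.trans h3⟩
  filter_upwards [hgc] with x hx
  rw [hx]

lemma MemH1.weakPartial_spec (hu : MemH1 Ω u) (i : Fin n) :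
    MemL2 Ω (weakPartial Ω i u) ∧ HasWeakPartial Ω i u (weakPartial Ω i u) := by
  rw [weakPartial, dif_pos (hu.2 i)]
  exact (hu.2 i).choose_spec

lemma HasTrace.smoothApprox (hu : MemH1 Ω u) (h : HasTrace Ω u g) :
    SmoothApprox Ω u (fun i => weakPartial Ω i u) g := by
  obtain ⟨hg, φ, hφ, h1, h2, h3⟩ := h
  exact SmoothApprox.of_seq hu.1 (fun i => (hu.weakPartial_spec i).1) hg hφ h1 h2 h3

lemma SmoothApprox.memH1 (h : SmoothApprox Ω u G g) : MemH1 Ω u :=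
  ⟨h.memL2, fun i => ⟨G i, h.grad_memL2 i, h.hasWeakPartial i⟩⟩

lemma MemL2.integrable (hΩ : IsBoundedLipschitzDomain Ω) (hu : MemL2 Ω u) :
    Integrable u (volume.restrict Ω) := by
  have : IsFiniteMeasure (volume.restrict Ω) := ⟨by
    rw [Measure.restrict_apply_univ]; exact hΩ.isBounded.measure_lt_top⟩
  exact MemLp.integrable (by norm_num) hu

/-- Weak partial derivatives are unique. -/
lemma HasWeakPartial.ae_eq (hΩ : IsBoundedLipschitzDomain Ω) {i : Fin n} {g g' : Rn n → ℝ}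
    (hg : MemL2 Ω g) (hg' : MemL2 Ω g') (h : HasWeakPartial Ω i u g)
    (h' : HasWeakPartial Ω i u g') : g =ᵐ[volOn Ω] g' := by
  have hint := (hg.integrable hΩ).sub (hg'.integrable hΩ)
  have key := hΩ.isOpen.ae_eq_zero_of_integral_contDiff_smul_eq_zero (μ := volume)
    (f := fun x => g x - g' x) (IntegrableOn.locallyIntegrableOn hint) fun χ hχ hχc hχΩ => by
      have hχ2 : MemL2 Ω χ := hχ.continuous.memLp_of_hasCompactSupport hχc
      have e1 : ∫ x, χ x • (g x - g' x) = ∫ x in Ω, χ x • (g x - g' x) :=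
        (setIntegral_eq_integral_of_forall_compl_eq_zero fun x hx => by
          rw [image_eq_zero_of_notMem_tsupport fun h => hx (hχΩ h), zero_smul]).symm
      have e2 : ∫ x in Ω, χ x • (g x - g' x) =
          (∫ x in Ω, g x * χ x) - ∫ x in Ω, g' x * χ x := by
        rw [← integral_sub (hg.integrable_mul hχ2) (hg'.integrable_mul hχ2)]
        exact integral_congr_ae (Eventually.of_forall fun x => by simp only [smul_eq_mul]; ring)
      have e3 := (h χ hχ hχc hχΩ).symm.trans (h' χ hχ hχc hχΩ)
      rw [e1, e2]
      linarith
  rw [volOn, Filter.EventuallyEq, ae_restrict_iff' hΩ.isOpen.measurableSet]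
  filter_upwards [key] with x hx hxΩ
  exact sub_eq_zero.1 (hx hxΩ)

lemma SmoothApprox.weakPartial_ae_eq (hΩ : IsBoundedLipschitzDomain Ω)
    (h : SmoothApprox Ω u G g) (i : Fin n) : weakPartial Ω i u =ᵐ[volOn Ω] G i :=
  HasWeakPartial.ae_eq hΩ (h.memH1.weakPartial_spec i).1 (h.grad_memL2 i)
    (h.memH1.weakPartial_spec i).2 (h.hasWeakPartial i)

/-- `HasTrace` refers to the chosen `weakPartial`, so uniqueness of weak derivatives is what allows
the return from an explicit gradient `G`. -/
lemma SmoothApprox.hasTrace (hΩ : IsBoundedLipschitzDomain Ω) (h : SmoothApprox Ω u G g) :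
    HasTrace Ω u g := by
  obtain ⟨φ, hφ, h1, h2, h3⟩ := h.exists_seq
  refine ⟨h.memLp_trace, φ, hφ, h1, fun i => (h2 i).congr fun m => eLpNorm_congr_ae ?_, h3⟩
  filter_upwards [h.weakPartial_ae_eq hΩ i] with x hx
  rw [hx]

/-! ### The pairing `⟨Au - f, v⟩` and Green's formula. -/

section Pairing

variable (b : Fin n → ℝ) (k : ℝ) {f : Rn n → ℝ}

/-- The zeroth order part `∑ᵢ bᵢ ∂ᵢu + k u - f`. -/
noncomputable def lowerOrder (Ω : Set (Rn n)) (b : Fin n → ℝ) (k : ℝ) (f u : Rn n → ℝ)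
    (x : Rn n) : ℝ := (∑ i, b i * weakPartial Ω i u x) + k * u x - f x

lemma memL2_lowerOrder (hf : MemL2 Ω f) (hu : MemH1 Ω u) : MemL2 Ω (lowerOrder Ω b k f u) :=
  ((memLp_finsetSum _ fun i _ => (hu.weakPartial_spec i).1.const_mul (b i)).add
    (hu.1.const_mul k)).sub hf

/-- Replacing the chosen `weakPartial` of `v` by an explicit gradient `V` makes linearity in `v`
visible. -/
lemma pairingRes_eq (hΩ : IsBoundedLipschitzDomain Ω) (hf : MemL2 Ω f) (hu : MemH1 Ω u)
    (hv : SmoothApprox Ω v V c) :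
    pairingRes Ω b k f u v = (∑ i, ∫ x in Ω, weakPartial Ω i u x * V i x)
      + ∫ x in Ω, lowerOrder Ω b k f u x * v x := by
  have h1 : ∀ i, Integrable (fun x => weakPartial Ω i u x * V i x) (volume.restrict Ω) :=
    fun i => (hu.weakPartial_spec i).1.integrable_mul (hv.grad_memL2 i)
  have h2 := (memL2_lowerOrder b k hf hu).integrable_mul hv.memL2
  have h3 := hf.integrable_mul hv.memL2
  have h4 : pairingA Ω b k u v = ∫ x in Ω, ((∑ i, weakPartial Ω i u x * V i x)
      + lowerOrder Ω b k f u x * v x + f x * v x) := by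
    refine integral_congr_ae ?_
    filter_upwards [ae_all_iff.2 fun i => hv.weakPartial_ae_eq hΩ i] with x hx
    simp_rw [hx, lowerOrder, ← Finset.sum_mul]
    ring
  have h5 : Integrable (fun x => (∑ i, weakPartial Ω i u x * V i x)
      + lowerOrder Ω b k f u x * v x) (volume.restrict Ω) :=
    (integrable_finsetSum _ fun i _ => h1 i).add h2
  rw [pairingRes, h4, integral_add h5 h3,
    integral_add (integrable_finsetSum _ fun i _ => h1 i) h2,
    integral_finsetSum _ fun i _ => h1 i]
  ring

lemma pairingRes_add (hΩ : IsBoundedLipschitzDomain Ω) (hf : MemL2 Ω f) (hu : MemH1 Ω u)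
    {v' c' : Rn n → ℝ} {V' : Fin n → Rn n → ℝ} (hv : SmoothApprox Ω v V c)
    (hv' : SmoothApprox Ω v' V' c') :
    pairingRes Ω b k f u (fun x => v x + v' x) =
      pairingRes Ω b k f u v + pairingRes Ω b k f u v' := by
  have h2 := memL2_lowerOrder b k hf hu
  rw [pairingRes_eq b k hΩ hf hu (hv.add hv'), pairingRes_eq b k hΩ hf hu hv,
    pairingRes_eq b k hΩ hf hu hv']
  simp_rw [mul_add]
  rw [integral_add (h2.integrable_mul hv.memL2) (h2.integrable_mul hv'.memL2)]
  have h1 : ∀ i, ∫ x in Ω, (weakPartial Ω i u x * V i x + weakPartial Ω i u x * V' i x) =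
      (∫ x in Ω, weakPartial Ω i u x * V i x) + ∫ x in Ω, weakPartial Ω i u x * V' i x :=
    fun i => integral_add ((hu.weakPartial_spec i).1.integrable_mul (hv.grad_memL2 i))
      ((hu.weakPartial_spec i).1.integrable_mul (hv'.grad_memL2 i))
  simp_rw [h1]
  rw [Finset.sum_add_distrib]
  ring

lemma memL2_strongA_sub (hf : MemL2 Ω f) (hu : MemH2 Ω u) :
    MemL2 Ω (fun x => strongA Ω b k u x - f x) :=
  (((memLp_finsetSum _ fun i _ => ((hu.2 i).weakPartial_spec i).1).neg.add
    (memLp_finsetSum _ fun i _ => (hu.1.weakPartial_spec i).1.const_mul (b i))).add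
      (hu.1.1.const_mul k)).sub hf

/-- Green's formula: for `u ∈ H²(Ω)` and `v` with vanishing trace, `⟨A u - f, v⟩` is the `L²`
inner product of `A u - f` and `v`. -/
lemma pairingRes_eq_integral_strongA (hn : 1 ≤ n) (hΩ : IsBoundedLipschitzDomain Ω)
    (hf : MemL2 Ω f) (hu : MemH2 Ω u) (hv : SmoothApprox Ω v V 0) :
    pairingRes Ω b k f u v = ∫ x in Ω, (strongA Ω b k u x - f x) * v x := by
  -- The regularity `u ∈ H²` provides the `L²` weak derivative of `∂ᵢu` required to move the
  -- gradient off `v`.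
  have h1 : ∀ i, ∫ x in Ω, weakPartial Ω i u x * V i x =
      -∫ x in Ω, weakPartial Ω i (weakPartial Ω i u) x * v x := fun i =>
    hv.integral_mul_grad hn hΩ (hu.1.weakPartial_spec i).1 ((hu.2 i).weakPartial_spec i).1
      ((hu.2 i).weakPartial_spec i).2
  have h2 : ∀ i, Integrable (fun x => weakPartial Ω i (weakPartial Ω i u) x * v x)
      (volume.restrict Ω) := fun i => ((hu.2 i).weakPartial_spec i).1.integrable_mul hv.memL2
  rw [pairingRes_eq b k hΩ hf hu.1 hv]
  simp_rw [h1]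
  rw [Finset.sum_neg_distrib, ← integral_finsetSum _ fun i _ => h2 i, neg_add_eq_sub,
    ← integral_sub ((memL2_lowerOrder b k hf hu.1).integrable_mul hv.memL2)
      (integrable_finsetSum _ fun i _ => h2 i)]
  refine integral_congr_ae (Eventually.of_forall fun x => ?_)
  simp only [strongA, lowerOrder, ← Finset.sum_mul]
  ring

end Pairing

lemma integral_mul_le_normL2 {a : Rn n → ℝ} (ha : MemL2 Ω a) (hv : MemL2 Ω v) :
    ∫ x in Ω, a x * v x ≤ normL2 Ω a * normL2 Ω v := by
  have h := ENNReal.toReal_mono (ENNReal.mul_ne_top ha.2.ne hv.2.ne)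
    (enorm_integral_mul_le (volOn Ω) ha.1 hv.1)
  rw [toReal_enorm, ENNReal.toReal_mul] at h
  exact (Real.le_norm_self _).trans h

lemma normL2_sq (hv : MemL2 Ω v) : normL2 Ω v ^ 2 = ∫ x in Ω, |v x| ^ 2 := by
  have hm : AEStronglyMeasurable (fun x => |v x| ^ 2) (volume.restrict Ω) := hv.1.norm.pow 2
  rw [normL2, ← ENNReal.toReal_pow, eLpNorm_two_sq,
    integral_eq_lintegral_of_nonneg_ae (Eventually.of_forall fun x => by positivity) hm]
  congr 1
  refine lintegral_congr fun x => ?_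
  rw [ENNReal.ofReal_pow (abs_nonneg _), ← Real.norm_eq_abs, ofReal_norm]

end ObstacleProblem

/-! ### Assembly of the main inequality. -/

open ObstacleProblem

theorem mainTheorem12 {n : ℕ} (hn : 1 ≤ n)
    (Ω : Set (ObstacleProblem.Rn n)) (hΩ : ObstacleProblem.IsBoundedLipschitzDomain Ω)
    (b : Fin n → ℝ) (k : ℝ)
    (f : ObstacleProblem.Rn n → ℝ) (hf : ObstacleProblem.MemL2 Ω f)
    (h : ObstacleProblem.Rn n → ℝ) (hh : ObstacleProblem.MemHHalf Ω h)
    (ψ : ObstacleProblem.Rn n → ℝ) (hψ : ObstacleProblem.MemH1 Ω ψ)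
    (ψb : ObstacleProblem.Rn n → ℝ) (hψb : ObstacleProblem.HasTrace Ω ψ ψb)
    (hψh : ∀ᵐ x ∂(ObstacleProblem.surfaceMeasure Ω), ψb x ≤ h x)
    (ustar : ObstacleProblem.Rn n → ℝ)
    (hustar : ObstacleProblem.IsVISolution Ω b k f ψ h ustar)
    (hH2 : ObstacleProblem.MemH2 Ω ustar)
    (uhat : ObstacleProblem.Rn n → ℝ) (huhat : ObstacleProblem.MemH1 Ω uhat)
    (uhatb : ObstacleProblem.Rn n → ℝ) (huhatb : ObstacleProblem.HasTrace Ω uhat uhatb)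
    (hbc : ∀ᵐ x ∂(ObstacleProblem.surfaceMeasure Ω), uhatb x = h x)
    (ε : ℝ) (hε : 0 < ε) (wb wo : ℝ)
    (hwo : 1 / (4 * ε) *
      ObstacleProblem.normL2 Ω (fun x => ObstacleProblem.strongA Ω b k ustar x - f x) ^ 2 ≤ wo) :
    ObstacleProblem.pairingRes Ω b k f ustar (fun x => ustar x - uhat x)
      - ObstacleProblem.penaltyR Ω ψ h wb wo uhat uhatb ≤ ε := by
  have hu := hustar.1
  have Su := HasTrace.smoothApprox hu.1 hu.2.2
  have Sw := HasTrace.smoothApprox huhat huhatb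
  have Sψ := HasTrace.smoothApprox hψ hψb
  have Sp := (Sψ.sub Sw).posPart (by
    filter_upwards [hψh, hbc] with x h1 h2
    linarith)
  set p : Rn n → ℝ := fun x => max (ψ x - uhat x) 0 with hp
  have Sv := (Sw.add Sp).congr_trace (c := h) (by
    filter_upwards [hbc] with x hx
    simp [hx])
  -- The competitor is `max(û, ψ)`, the least modification of `û` that respects the obstacle; its
  -- trace is still `h` because `p` has zero trace.
  have hvK : (fun x => uhat x + p x) ∈ constraintSet Ω ψ h := by
    refine ⟨Sv.memH1, Eventually.of_forall fun x => ?_, Sv.hasTrace hΩ⟩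
    have := le_max_left (ψ x - uhat x) 0
    simp only [hp]
    linarith
  have hVI := hustar.2 _ hvK
  have hsplit : (fun x => ustar x - uhat x) = fun x => (ustar x - (uhat x + p x)) + p x := by
    ext x; ring
  have hadd := pairingRes_add b k hΩ hf hu.1 (Su.sub Sv) Sp
  have hgreen := pairingRes_eq_integral_strongA b k hn hΩ hf hH2 Sp
  have hCS := integral_mul_le_normL2 (memL2_strongA_sub b k hf hH2) Sp.memL2
  -- Hence neither the size nor the sign of `wb` matters.
  have hlb : lossBoundary Ω h uhatb = 0 := by
    refine integral_eq_zero_of_ae ?_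
    filter_upwards [hbc] with x hx
    simp [hx]
  have hlo : lossObstacle Ω ψ uhat = normL2 Ω p ^ 2 := (normL2_sq Sp.memL2).symm
  rw [hsplit, hadd, hgreen, penaltyR, hlb, hlo, mul_zero, zero_add]
  set X := normL2 Ω fun x => strongA Ω b k ustar x - f x
  set Y := normL2 Ω p
  have hY : 1 / (4 * ε) * X ^ 2 * Y ^ 2 ≤ wo * Y ^ 2 := by gcongr
  -- Young's inequality, from the square `(2ε - XY)² ≥ 0`; it accounts for the constant `1 / (4ε)`
  -- in the threshold for the weight.
  have hXY : X * Y ≤ ε + 1 / (4 * ε) * X ^ 2 * Y ^ 2 := by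
    have h1 : ε + 1 / (4 * ε) * X ^ 2 * Y ^ 2 - X * Y = (2 * ε - X * Y) ^ 2 / (4 * ε) := by
      field_simp
      ring
    have h2 : 0 ≤ (2 * ε - X * Y) ^ 2 / (4 * ε) := by positivity
    linarith
  linarith
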